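/- **Setting.** A *stationary Bratteli diagram* $B$ has levels $V_0=\{v_0\}$ and $V_n$ ($n\ge 1$), all $V_n$ with $n\ge1$ being copies of one finite set $V$, finite sets $E_n$ of edges from $V_{n-1}$ to $V_n$ such that every vertex emits an edge and every vertex other than $v_0$ receives an edge, and the number $F_{vw}$ of edges from $w\in V_n$ to $v\in V_{n+1}$ is the same for all $n\ge1$. (The numbers of edges from $v_0$ to the vertices of $V_1$ may be arbitrary positive integers.) Let $X_B$ be the space of infinite paths starting at $v_0$, with the topology generated by the cylinder sets. Two paths are *tail equivalent*, written $x\,\mathcal R\,y$, if they have the same edges from some level on. Let $\mathcal D$ be the set of stationary Bratteli diagrams $B$, simple or not, for which $X_B$ is a Cantor set and every $\mathcal R$-class is infinite. $B$ is *simple* if every $\mathcal R$-class is dense in $X_B$. A Borel measure on $X_B$ is *$\mathcal R$-invariant* if any two cylinder sets given by finite paths from $v_0$ to the same vertex have equal measure; it is *ergodic* if every Borel union of $\mathcal R$-classes is null or has null complement. Let $\mathcal S$ be the set of all non-atomic ergodic $\mathcal R$-invariant Borel probability measures on path spaces of diagrams from $\mathcal D$. For a measure $\mu$ on a Cantor set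 $X$ put $S(\mu)=\{\mu(U): U\subset X \text{ clopen}\}$. The measure $\mu$ is *good* if $\mu(V)>0$ for every non-empty clopen $V$, and whenever $U,V$ are clopen with $\mu(U)<\mu(V)$ there is a clopen $W\subset V$ with $\mu(W)=\mu(U)$. **Proposition.** For every $\mu\in\mathcal S$ there exists a good measure $\nu\in\mathcal S$, living on the path space of a simple stationary Bratteli diagram in $\mathcal D$ in which exactly one edge joins $v_0$ to each vertex of $V_1$, such that $S(\mu)=S(\nu)$. -/

import Mathlib

open MeasureTheory

/-- A stationary Bratteli diagram. The level `V₀` is a single point, each level `V₁, V₂, …` is a copy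
of the finite set `V`; the edges from `V₀` to `V₁` form the finite set `E₀` (an edge of `E₀` is given
by its range), and for every `n ≥ 1` the edges from `Vₙ` to `Vₙ₊₁` form a copy of the finite set `E`.
So all incidence matrices after the first level equal `F v w = #{e ∈ E | rng e = v, src e = w}`, and
the numbers of edges from the top vertex to the vertices of `V₁` are arbitrary. As for every
Bratteli diagram, each vertex emits an edge, and each vertex other than the top one receives one. -/
structure StationaryBratteliDiagram where
  V : Type
  E₀ : Type
  E : Type
  finite_V : Finite V
  finite_E₀ : Finite E₀
  finite_E : Finite E
  rng₀ : E₀ → V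
  src : E → V
  rng : E → V
  nonempty_E₀ : Nonempty E₀
  rng₀_surjective : Function.Surjective rng₀
  src_surjective : Function.Surjective src
  rng_surjective : Function.Surjective rng

namespace StationaryBratteliDiagram

variable (B : StationaryBratteliDiagram)

/-- The path space `X_B`: infinite paths `(e₀, (e₁, e₂, …))` starting at the top vertex. -/
def PathSpace : Type :=
  {p : B.E₀ × (ℕ → B.E) // B.rng₀ p.1 = B.src (p.2 0) ∧ ∀ n, B.rng (p.2 n) = B.src (p.2 (n + 1))}

variable {B}

/-- The first edge of a path. -/
def PathSpace.first (x : B.PathSpace) : B.E₀ := x.1.1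

/-- The edge of a path from level `n + 1` to level `n + 2`. -/
def PathSpace.edge (x : B.PathSpace) (n : ℕ) : B.E := x.1.2 n

/-- The vertex of a path at level `n + 1`. -/
def PathSpace.vertex (x : B.PathSpace) (n : ℕ) : B.V := B.src (x.edge n)

/-- The cylinder set of all paths whose first `n + 1` edges are those of `x`. Every finite path
from the top vertex extends to an infinite one, so these are all the cylinder sets given by finite
paths of length `n + 1`; this one ends at the vertex `x.vertex n` of level `n + 1`. -/
def cylinder (x : B.PathSpace) (n : ℕ) : Set B.PathSpace :=
  {y | y.first = x.first ∧ ∀ i < n, y.edge i = x.edge i}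

/-- The topology of the path space: induced by the product of the discrete topologies
(the cylinder sets form a basis, see `isTopologicalBasis_cylinder`). -/
instance : TopologicalSpace B.PathSpace :=
  TopologicalSpace.induced (fun x : B.PathSpace => (x.first, x.edge))
    (@instTopologicalSpaceProd B.E₀ (ℕ → B.E) ⊥ (@Pi.topologicalSpace ℕ (fun _ => B.E) fun _ => ⊥))

instance : MeasurableSpace B.PathSpace := borel B.PathSpace

instance : BorelSpace B.PathSpace := ⟨rfl⟩

theorem isTopologicalBasis_cylinder :
    TopologicalSpace.IsTopologicalBasis
      {U : Set B.PathSpace | ∃ (x : B.PathSpace) (n : ℕ), U = cylinder x n} := by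
  let _ : TopologicalSpace B.E₀ := ⊥
  let _ : TopologicalSpace B.E := ⊥
  have _ : DiscreteTopology B.E₀ := ⟨rfl⟩
  have _ : DiscreteTopology B.E := ⟨rfl⟩
  have hc : Continuous (fun x : B.PathSpace => (x.first, x.edge)) := continuous_induced_dom
  have hf : Continuous (fun x : B.PathSpace => x.first) := continuous_fst.comp hc
  have he : ∀ i, Continuous (fun x : B.PathSpace => x.edge i) := fun i =>
    (continuous_apply i).comp (continuous_snd.comp hc)
  refine TopologicalSpace.isTopologicalBasis_of_isOpen_of_nhds ?_ ?_
  · rintro U ⟨x, n, rfl⟩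
    have h : cylinder x n = (fun y : B.PathSpace => y.first) ⁻¹' {x.first} ∩
        ⋂ i ∈ Finset.range n, (fun y : B.PathSpace => y.edge i) ⁻¹' {x.edge i} := by
      ext y; simp [cylinder]
    rw [h]
    exact ((isOpen_discrete _).preimage hf).inter
      (isOpen_biInter_finset fun i _ => (isOpen_discrete _).preimage (he i))
  · intro x U hx hU
    obtain ⟨W, hW, rfl⟩ := isOpen_induced_iff.1 hU
    obtain ⟨a, b, _, hb, hxa, hxb, hab⟩ := isOpen_prod_iff.1 hW x.first x.edge hx
    obtain ⟨I, u, hu, hIu⟩ := isOpen_pi_iff.1 hb x.edge hxb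
    refine ⟨cylinder x (I.sup id + 1), ⟨x, _, rfl⟩, ⟨rfl, fun _ _ => rfl⟩, ?_⟩
    rintro y ⟨hy0, hy⟩
    refine hab ⟨?_, hIu fun i hi => ?_⟩
    · simpa [hy0] using hxa
    · have hle : i ≤ I.sup id := Finset.le_sup (f := id) hi
      have := hy i (by omega)
      simpa [this] using (hu i hi).2

/-- Tail equivalence of infinite paths. -/
def TailEquiv (x y : B.PathSpace) : Prop := ∃ N, ∀ i ≥ N, x.edge i = y.edge i

variable (B)

/-- The tail equivalence relation is aperiodic: all its classes are infinite. -/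
def IsAperiodic : Prop := ∀ x : B.PathSpace, {y | TailEquiv x y}.Infinite

/-- A diagram is simple if its tail equivalence relation is minimal: all its classes are dense. -/
def IsSimple : Prop := ∀ x : B.PathSpace, Dense {y | TailEquiv x y}

variable {B}

/-- Invariance with respect to the tail equivalence relation: cylinder sets given by finite paths
with the same terminal vertex have the same measure. -/
def IsTailInvariant (μ : Measure B.PathSpace) : Prop :=
  ∀ (n : ℕ) (x y : B.PathSpace), x.vertex n = y.vertex n → μ (cylinder x n) = μ (cylinder y n)

/-- Ergodicity with respect to the tail equivalence relation: Borel sets that are unions of classes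
have measure `0` or full measure. -/
def IsTailErgodic (μ : Measure B.PathSpace) : Prop :=
  ∀ A : Set B.PathSpace, MeasurableSet A → (∀ x y, TailEquiv x y → x ∈ A → y ∈ A) →
    μ A = 0 ∨ μ Aᶜ = 0

end StationaryBratteliDiagram

/-- Cantor sets, through their topological characterization. -/
structure IsCantorSpace (X : Type*) [TopologicalSpace X] : Prop where
  nonempty : Nonempty X
  compact : CompactSpace X
  metrizable : TopologicalSpace.MetrizableSpace X
  totallyDisconnected : TotallyDisconnectedSpace X
  perfect : PerfectSpace X

namespace StationaryBratteliDiagram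

/-- The class `𝒟` of stationary diagrams under consideration (simple or not): the path space is a
Cantor set and the tail equivalence relation is aperiodic. -/
structure MemD (B : StationaryBratteliDiagram) : Prop where
  cantor : IsCantorSpace B.PathSpace
  aperiodic : B.IsAperiodic

/-- The class `𝒮`: non-atomic ergodic invariant Borel probability measures on the path spaces of
diagrams from `𝒟`. -/
structure MemS (B : StationaryBratteliDiagram) (μ : Measure B.PathSpace) : Prop where
  memD : B.MemD
  isProbability : IsProbabilityMeasure μ
  noAtoms : ∀ x : B.PathSpace, μ {x} = 0
  invariant : IsTailInvariant μ
  ergodic : IsTailErgodic μ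

end StationaryBratteliDiagram

/-- The clopen values set `S(μ)`. -/
def clopenValues {X : Type*} [TopologicalSpace X] [MeasurableSpace X] (μ : Measure X) : Set ℝ :=
  {a | ∃ U : Set X, IsClopen U ∧ μ.real U = a}

/-- A full measure: every non-empty clopen set has positive measure. -/
def IsFullMeasure {X : Type*} [TopologicalSpace X] [MeasurableSpace X] (μ : Measure X) : Prop :=
  ∀ V : Set X, IsClopen V → V.Nonempty → 0 < μ V

/-- A clopen set `V` is good for `μ`. -/
def IsGoodSet {X : Type*} [TopologicalSpace X] [MeasurableSpace X] (μ : Measure X) (V : Set X) :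
    Prop :=
  ∀ U : Set X, IsClopen U → μ U < μ V → ∃ W : Set X, IsClopen W ∧ W ⊆ V ∧ μ W = μ U

/-- A good measure: it is full and every clopen set is good for it. -/
def IsGoodMeasure {X : Type*} [TopologicalSpace X] [MeasurableSpace X] (μ : Measure X) : Prop :=
  IsFullMeasure μ ∧ ∀ V : Set X, IsClopen V → IsGoodSet μ V

/-! An invariant measure is determined by its weights, the measures of cylinders as a function of
level and terminal vertex; these satisfy (weights at level `n`) = `incidence` · (weights at level `n
+ 1`). Pass to a power `A` of the incidence matrix whose zero pattern is idempotent. Ergodicity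
makes almost every path eventually stay, at the telescoped levels, in one class `α` on which `A` is
positive. For a positive matrix the non-negative solutions of the recursion form a ray
(`exists_eq_mul_of_pos`), and the shift maps solutions to solutions. So the weights at level `p * j`
are `x / l ^ j` with `A x = l x` (`exists_isDistinguished`). Aperiodicity forces `l > 1`.

Let `H` be the group generated by the numbers `x w`; then `l H ⊆ H`. The heart of the proof is that
the clopen values are exactly the numbers of `[0, 1]` lying in some `l⁻ⁿ H` (`values_eq`). A clopen
set corresponds to a vector `k` with `0 ≤ k ≤ pathCount`, so an arbitrary integer vector must be
brought between these bounds without changing its value. Multiplying a row vector `k` with `k x > 0`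
by powers of `A` makes its entries on `α` tend to infinity. Outside `α` this gives no control, but
there the `x w` are rational combinations of the entries on `α` (`mem_span_rat`), so coefficients
can be reduced modulo a fixed `m` (`exists_reduced`). Non-negativity outside `α` then survives
multiplication by `A`.

For the simple diagram, take one vertex for each edge of `E₀` ending at a vertex of positive weight,
with the entry of `x` there as its weight. The same two facts write `l ^ N * x w` as a combination
of the `x v` with large coefficients, which yields a matrix with entries at least 2 and this weight
vector as eigenvector. For such a matrix the invariant measure is ergodic and good
(`exists_good_measure`). Its value set is given by `values_eq` with every vertex in `α`, and depends
only on the group `H` and on the powers of `l`, so it is the same set. -/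

namespace StationaryBratteliDiagram

-- Path surgery, cylinders, and sets determined at a fixed level

attribute [instance] finite_V finite_E₀ finite_E nonempty_E₀

noncomputable instance instFintypeV (B : StationaryBratteliDiagram) : Fintype B.V :=
  Fintype.ofFinite _
noncomputable instance instFintypeE₀ (B : StationaryBratteliDiagram) : Fintype B.E₀ :=
  Fintype.ofFinite _
noncomputable instance instFintypeE (B : StationaryBratteliDiagram) : Fintype B.E :=
  Fintype.ofFinite _
noncomputable instance (B : StationaryBratteliDiagram) : DecidableEq B.V := Classical.decEq _
noncomputable instance (B : StationaryBratteliDiagram) : DecidableEq B.E := Classical.decEq _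

variable {B : StationaryBratteliDiagram}

theorem PathSpace.ext_edges {x y : B.PathSpace} (h₀ : x.first = y.first)
    (h : ∀ i, x.edge i = y.edge i) : x = y :=
  Subtype.ext (Prod.ext h₀ (funext h))

theorem PathSpace.rng₀_first (x : B.PathSpace) : B.rng₀ x.first = x.vertex 0 := x.2.1

theorem PathSpace.rng_edge (x : B.PathSpace) (n : ℕ) : B.rng (x.edge n) = x.vertex (n + 1) :=
  x.2.2 n

/-- The path which follows `x` up to level `n + 1` and the edges `t` afterwards. -/
def splice (x : B.PathSpace) (n : ℕ) (t : ℕ → B.E) (h₀ : B.src (t 0) = x.vertex n)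
    (h : ∀ i, B.rng (t i) = B.src (t (i + 1))) : B.PathSpace :=
  ⟨(x.first, fun i => if i < n then x.edge i else t (i - n)), by
    constructor
    · rcases Nat.eq_zero_or_pos n with rfl | hn
      · simpa [h₀] using x.rng₀_first
      · simpa [hn, PathSpace.vertex] using x.rng₀_first
    · intro i
      rcases lt_trichotomy (i + 1) n with hi | hi | hi
      · have : i < n := by omega
        simpa [hi, this, PathSpace.vertex] using x.rng_edge i
      · subst hi
        simpa [h₀] using x.rng_edge i
      · have h1 : ¬ i < n := by omega
        have h2 : ¬ i + 1 < n := by omega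
        have h3 : i + 1 - n = (i - n) + 1 := by omega
        simpa [h1, h2, h3] using h (i - n)⟩

theorem splice_edge_lt (x : B.PathSpace) {n i : ℕ} (t : ℕ → B.E) (h₀ h) (hi : i < n) :
    (splice x n t h₀ h).edge i = x.edge i := if_pos hi

theorem splice_edge_ge (x : B.PathSpace) {n i : ℕ} (t : ℕ → B.E) (h₀ h) (hi : n ≤ i) :
    (splice x n t h₀ h).edge i = t (i - n) := if_neg (not_lt.2 hi)

theorem splice_mem_cylinder (x : B.PathSpace) (n : ℕ) (t : ℕ → B.E) (h₀ h) :
    splice x n t h₀ h ∈ cylinder x n :=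
  ⟨rfl, fun _ hi => splice_edge_lt x t h₀ h hi⟩

variable (B) in
/-- A ray of edges starting at the vertex `v`. -/
noncomputable def rayFrom (v : B.V) : ℕ → B.E
  | 0 => (B.src_surjective v).choose
  | n + 1 => (B.src_surjective (B.rng (rayFrom v n))).choose

theorem src_rayFrom_zero (v : B.V) : B.src (rayFrom B v 0) = v :=
  (B.src_surjective v).choose_spec

theorem src_rayFrom_succ (v : B.V) (n : ℕ) :
    B.src (rayFrom B v (n + 1)) = B.rng (rayFrom B v n) :=
  (B.src_surjective (B.rng (rayFrom B v n))).choose_spec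

/-- A path which follows `x` up to level `n + 1` and takes the edge `e` next. -/
noncomputable def extend (x : B.PathSpace) (n : ℕ) (e : B.E) (he : B.src e = x.vertex n) :
    B.PathSpace :=
  splice x n (fun i => Nat.casesOn i e (rayFrom B (B.rng e))) he
    (fun i => by cases i with
      | zero => exact (src_rayFrom_zero _).symm
      | succ i => exact (src_rayFrom_succ _ i).symm)

theorem extend_mem_cylinder (x : B.PathSpace) (n : ℕ) (e : B.E) (he : B.src e = x.vertex n) :
    extend x n e he ∈ cylinder x n := splice_mem_cylinder _ _ _ _ _

theorem extend_edge (x : B.PathSpace) (n : ℕ) (e : B.E) (he : B.src e = x.vertex n) :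
    (extend x n e he).edge n = e := by
  simp [extend, splice_edge_ge]

theorem extend_vertex (x : B.PathSpace) (n : ℕ) (e : B.E) (he : B.src e = x.vertex n) :
    (extend x n e he).vertex (n + 1) = B.rng e := by
  rw [← PathSpace.rng_edge, extend_edge]

theorem exists_first_eq (e : B.E₀) : ∃ x : B.PathSpace, x.first = e :=
  ⟨⟨(e, rayFrom B (B.rng₀ e)), (src_rayFrom_zero _).symm,
    fun n => (src_rayFrom_succ _ n).symm⟩, rfl⟩

theorem exists_vertex_eq (n : ℕ) (v : B.V) : ∃ x : B.PathSpace, x.vertex n = v := by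
  induction n generalizing v with
  | zero =>
    obtain ⟨e, rfl⟩ := B.rng₀_surjective v
    obtain ⟨x, rfl⟩ := exists_first_eq e
    exact ⟨x, x.rng₀_first.symm⟩
  | succ n ih =>
    obtain ⟨e, rfl⟩ := B.rng_surjective v
    obtain ⟨x, hx⟩ := ih (B.src e)
    exact ⟨extend x n e hx.symm, extend_vertex _ _ _ _⟩

instance : Nonempty B.PathSpace :=
  let ⟨x, _⟩ := exists_first_eq (Classical.arbitrary B.E₀); ⟨x⟩

instance : Nonempty B.V := ⟨B.rng₀ (Classical.arbitrary B.E₀)⟩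

theorem mem_cylinder_self (x : B.PathSpace) (n : ℕ) : x ∈ cylinder x n := ⟨rfl, fun _ _ => rfl⟩

theorem mem_cylinder_comm {x y : B.PathSpace} {n : ℕ} : y ∈ cylinder x n ↔ x ∈ cylinder y n :=
  ⟨fun h => ⟨h.1.symm, fun i hi => (h.2 i hi).symm⟩,
    fun h => ⟨h.1.symm, fun i hi => (h.2 i hi).symm⟩⟩

theorem mem_cylinder_trans {x y z : B.PathSpace} {n : ℕ} (hxy : y ∈ cylinder x n)
    (hyz : z ∈ cylinder y n) : z ∈ cylinder x n :=
  ⟨hyz.1.trans hxy.1, fun i hi => (hyz.2 i hi).trans (hxy.2 i hi)⟩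

theorem cylinder_eq_of_mem {x y : B.PathSpace} {n : ℕ} (h : y ∈ cylinder x n) :
    cylinder y n = cylinder x n :=
  Set.ext fun _ => ⟨mem_cylinder_trans h, mem_cylinder_trans (mem_cylinder_comm.1 h)⟩

theorem cylinder_anti (x : B.PathSpace) {m n : ℕ} (h : m ≤ n) : cylinder x n ⊆ cylinder x m :=
  fun _ hy => ⟨hy.1, fun i hi => hy.2 i (hi.trans_le h)⟩

theorem vertex_eq_of_mem {x y : B.PathSpace} {n m : ℕ} (h : y ∈ cylinder x n) (hm : m ≤ n) :
    y.vertex m = x.vertex m := by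
  cases m with
  | zero => rw [← y.rng₀_first, ← x.rng₀_first, h.1]
  | succ m => rw [← y.rng_edge, ← x.rng_edge, h.2 m hm]

theorem cylinder_inter_of_mem {x y z : B.PathSpace} {m n : ℕ} (h : m ≤ n)
    (hx : z ∈ cylinder x m) (hy : z ∈ cylinder y n) :
    cylinder x m ∩ cylinder y n = cylinder z n := by
  rw [← cylinder_eq_of_mem hx, ← cylinder_eq_of_mem hy]
  exact Set.inter_eq_right.2 (cylinder_anti z h)

theorem isOpen_cylinder (x : B.PathSpace) (n : ℕ) : IsOpen (cylinder x n) :=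
  isTopologicalBasis_cylinder.isOpen ⟨x, n, rfl⟩

/-- A set is of level `n` if it is a union of cylinders given by paths of length `n + 1`. -/
def IsLevel (n : ℕ) (U : Set B.PathSpace) : Prop := ∀ x ∈ U, cylinder x n ⊆ U

theorem IsLevel.mono {m n : ℕ} {U : Set B.PathSpace} (h : IsLevel m U) (hmn : m ≤ n) :
    IsLevel n U := fun x hx => (cylinder_anti x hmn).trans (h x hx)

theorem IsLevel.mem_iff {n : ℕ} {U : Set B.PathSpace} (h : IsLevel n U) {x y : B.PathSpace}
    (hxy : y ∈ cylinder x n) : y ∈ U ↔ x ∈ U :=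
  ⟨fun hy => h y hy (mem_cylinder_comm.1 hxy), fun hx => h x hx hxy⟩

theorem IsLevel.isOpen {n : ℕ} {U : Set B.PathSpace} (h : IsLevel n U) : IsOpen U := by
  have : U = ⋃ x ∈ U, cylinder x n := by
    ext y
    simp only [Set.mem_iUnion, exists_prop]
    exact ⟨fun hy => ⟨y, hy, mem_cylinder_self y n⟩, fun ⟨x, hx, hy⟩ => h x hx hy⟩
  rw [this]
  exact isOpen_biUnion fun x _ => isOpen_cylinder x n

theorem IsLevel.compl {n : ℕ} {U : Set B.PathSpace} (h : IsLevel n U) : IsLevel n Uᶜ :=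
  fun _ hx _ hy hyU => hx ((h.mem_iff hy).1 hyU)

theorem IsLevel.isClopen {n : ℕ} {U : Set B.PathSpace} (h : IsLevel n U) : IsClopen U :=
  ⟨⟨h.compl.isOpen⟩, h.isOpen⟩

theorem isLevel_cylinder (x : B.PathSpace) (n : ℕ) : IsLevel n (cylinder x n) :=
  fun _ hy => (cylinder_eq_of_mem hy).subset

theorem isClopen_cylinder (x : B.PathSpace) (n : ℕ) : IsClopen (cylinder x n) :=
  (isLevel_cylinder x n).isClopen

theorem measurableSet_cylinder (x : B.PathSpace) (n : ℕ) : MeasurableSet (cylinder x n) :=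
  (isOpen_cylinder x n).measurableSet

/-! ### Topology of the path space -/

section Embedding

/-- Composability of consecutive edges is a closed condition in a product of finite discrete spaces.
The path space inherits compactness, metrizability, total disconnectedness and second countability
from that product. -/
theorem exists_isClosedEmbedding (B : StationaryBratteliDiagram) :
    ∃ (_ : TopologicalSpace B.E₀) (_ : TopologicalSpace B.E) (_ : DiscreteTopology B.E₀)
      (_ : DiscreteTopology B.E),
      Topology.IsClosedEmbedding (fun x : B.PathSpace => (x.first, x.edge)) := by
  let _ : TopologicalSpace B.E₀ := ⊥
  let _ : TopologicalSpace B.E := ⊥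
  have _ : DiscreteTopology B.E₀ := ⟨rfl⟩
  have _ : DiscreteTopology B.E := ⟨rfl⟩
  refine ⟨_, _, ‹_›, ‹_›, ⟨⟨rfl⟩, fun x y h => ?_⟩, ?_⟩
  · exact PathSpace.ext_edges (congrArg Prod.fst h) (congrFun (congrArg Prod.snd h))
  · have : Set.range (fun x : B.PathSpace => (x.first, x.edge)) =
        {p | B.rng₀ p.1 = B.src (p.2 0)} ∩ ⋂ n, {p | B.rng (p.2 n) = B.src (p.2 (n + 1))} := by
      ext p
      simp only [Set.mem_range, Set.mem_inter_iff, Set.mem_iInter]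
      exact ⟨by rintro ⟨x, rfl⟩; exact ⟨x.2.1, x.2.2⟩, fun h => ⟨⟨p, h.1, h.2⟩, rfl⟩⟩
    rw [this]
    let _ : TopologicalSpace B.V := ⊥
    have _ : DiscreteTopology B.V := ⟨rfl⟩
    have c (f : B.E → B.V) : Continuous f := continuous_of_discreteTopology
    have c₀ (f : B.E₀ → B.V) : Continuous f := continuous_of_discreteTopology
    have ce (n : ℕ) : Continuous fun p : B.E₀ × (ℕ → B.E) => p.2 n :=
      (continuous_apply n).comp continuous_snd
    exact (isClosed_eq ((c₀ _).comp continuous_fst) ((c _).comp (ce 0))).inter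
      (isClosed_iInter fun n => isClosed_eq ((c _).comp (ce n)) ((c _).comp (ce (n + 1))))

instance : CompactSpace B.PathSpace := by
  obtain ⟨_, _, _, _, h⟩ := exists_isClosedEmbedding B
  exact h.compactSpace

instance : TopologicalSpace.MetrizableSpace B.PathSpace := by
  obtain ⟨_, _, _, _, h⟩ := exists_isClosedEmbedding B
  exact h.isEmbedding.metrizableSpace

instance : TotallyDisconnectedSpace B.PathSpace := by
  obtain ⟨_, _, _, _, h⟩ := exists_isClosedEmbedding B
  exact ⟨h.isEmbedding.isTotallyDisconnected (isTotallyDisconnected_of_totallyDisconnectedSpace _)⟩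

instance : SecondCountableTopology B.PathSpace := by
  obtain ⟨_, _, _, _, h⟩ := exists_isClosedEmbedding B
  exact h.isEmbedding.secondCountableTopology

end Embedding

/-- By compactness finitely many cylinders inside `U` cover it; the largest of their levels works.
-/
theorem exists_isLevel_of_isClopen {U : Set B.PathSpace} (hU : IsClopen U) : ∃ n, IsLevel n U := by
  have h : ∀ x ∈ U, ∃ n, cylinder x n ⊆ U := fun x hx => by
    obtain ⟨_, ⟨z, n, rfl⟩, hxz, hz⟩ :=
      isTopologicalBasis_cylinder.exists_subset_of_mem_open hx hU.isOpen
    exact ⟨n, (cylinder_eq_of_mem hxz).trans_subset hz⟩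
  choose! N hN using h
  obtain ⟨t, hcov⟩ := hU.isClosed.isCompact.elim_nhds_subcover' (fun x _ => cylinder x (N x))
    (fun x _ => (isOpen_cylinder x _).mem_nhds (mem_cylinder_self x _))
  refine ⟨t.sup fun x => N x, fun x hx => ?_⟩
  have hx' := hcov hx
  simp only [Set.mem_iUnion] at hx'
  obtain ⟨y, hy, hxy⟩ := hx'
  have hle : N y ≤ t.sup fun x => N x := Finset.le_sup (f := fun x : U => N x) hy
  exact (cylinder_anti x hle).trans ((cylinder_eq_of_mem hxy).trans_subset (hN y y.2))

/-! ### Finite paths -/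

variable (B) in
/-- The finite paths of length `n + 1` from the top vertex. -/
def Prefix (n : ℕ) : Type :=
  Set.range fun x : B.PathSpace => (x.first, fun i : Fin n => x.edge i)

instance (n : ℕ) : Finite (B.Prefix n) := inferInstanceAs (Finite (Set.range _))

noncomputable instance (n : ℕ) : Fintype (B.Prefix n) := Fintype.ofFinite _

/-- The initial segment of a path. -/
def PathSpace.toPrefix (n : ℕ) (x : B.PathSpace) : B.Prefix n := ⟨_, x, rfl⟩

/-- A path extending a given finite path. -/
noncomputable def Prefix.path {n : ℕ} (q : B.Prefix n) : B.PathSpace := q.2.choose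

theorem toPrefix_path {n : ℕ} (q : B.Prefix n) : q.path.toPrefix n = q :=
  Subtype.ext q.2.choose_spec

/-- The terminal vertex of a finite path. -/
noncomputable abbrev Prefix.endpoint {n : ℕ} (q : B.Prefix n) : B.V := q.path.vertex n

theorem toPrefix_eq_iff {n : ℕ} {x y : B.PathSpace} :
    y.toPrefix n = x.toPrefix n ↔ y ∈ cylinder x n := by
  constructor
  · intro h
    replace h : (y.first, fun i : Fin n => y.edge i) = (x.first, fun i : Fin n => x.edge i) :=
      congrArg Subtype.val h
    obtain ⟨h0, h1⟩ := Prod.mk.inj h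
    exact ⟨h0, fun i hi => congrFun h1 (⟨i, hi⟩ : Fin n)⟩
  · intro h
    exact Subtype.ext (Prod.ext h.1 (funext fun i => h.2 i i.2))

theorem path_toPrefix_mem (n : ℕ) (x : B.PathSpace) : (x.toPrefix n).path ∈ cylinder x n :=
  toPrefix_eq_iff.1 (toPrefix_path _)

theorem endpoint_toPrefix (n : ℕ) (x : B.PathSpace) : (x.toPrefix n).endpoint = x.vertex n :=
  vertex_eq_of_mem (path_toPrefix_mem n x) le_rfl

/-- Finite paths are extended by one edge in the evident way. -/
noncomputable def prefixSuccEquiv (B : StationaryBratteliDiagram) (n : ℕ) :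
    (Σ q : B.Prefix n, {e : B.E // B.src e = q.endpoint}) ≃ B.Prefix (n + 1) where
  toFun p := (extend p.1.path n p.2.1 p.2.2).toPrefix (n + 1)
  invFun r := ⟨r.path.toPrefix n, r.path.edge n, (endpoint_toPrefix n r.path).symm⟩
  left_inv p := by
    obtain ⟨q, e, he⟩ := p
    have h := path_toPrefix_mem (n + 1) (extend q.path n e he)
    have h1 : ((extend q.path n e he).toPrefix (n + 1)).path.toPrefix n = q := by
      refine Eq.trans (toPrefix_eq_iff.2 ?_) (toPrefix_path q)
      exact mem_cylinder_trans (extend_mem_cylinder _ _ _ _) (cylinder_anti _ n.le_succ h)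
    have h2 : ((extend q.path n e he).toPrefix (n + 1)).path.edge n = e := by
      rw [h.2 n n.lt_succ_self, extend_edge]
    refine Sigma.ext h1 ?_
    refine (Subtype.heq_iff_coe_eq ?_).2 h2
    intro x
    simp only [h1]
  right_inv r := by
    conv_rhs => rw [← toPrefix_path r]
    rw [toPrefix_eq_iff]
    have h := extend_mem_cylinder (r.path.toPrefix n).path n (r.path.edge n)
      (endpoint_toPrefix n r.path).symm
    have h' := path_toPrefix_mem n r.path
    refine ⟨h.1.trans h'.1, fun i hi => ?_⟩
    rcases Nat.lt_succ_iff_lt_or_eq.1 hi with hi | rfl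
    · exact (h.2 i hi).trans (h'.2 i hi)
    · exact extend_edge _ _ _ _

variable (B) in
/-- The incidence matrix: `incidence w v` is the number of edges from `w` to `v`. -/
noncomputable def incidence : Matrix B.V B.V ℕ :=
  fun w v => (Finset.univ.filter fun e : B.E => B.src e = w ∧ B.rng e = v).card

theorem sum_outEdges {R : Type*} [CommSemiring R] (w : B.V) (g : B.V → R) :
    ∑ e : {e : B.E // B.src e = w}, g (B.rng e) = ∑ v, (B.incidence w v : R) * g v := by
  have h1 : ∑ e : {e : B.E // B.src e = w}, g (B.rng e) =
      ∑ e ∈ Finset.univ.filter (fun e : B.E => B.src e = w), g (B.rng e) :=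
    (Finset.sum_subtype _ (by simp) (fun e => g (B.rng e))).symm
  rw [h1, ← Finset.sum_fiberwise _ (fun e => B.rng e)]
  refine Finset.sum_congr rfl fun v _ => ?_
  rw [Finset.filter_filter, Finset.sum_congr rfl (g := fun _ => g v), Finset.sum_const,
    nsmul_eq_mul]
  · rfl
  · intro e he
    rw [(Finset.mem_filter.1 he).2.2]

theorem exists_edge_iff {w v : B.V} : B.incidence w v ≠ 0 ↔ ∃ e, B.src e = w ∧ B.rng e = v := by
  rw [incidence, Finset.card_ne_zero, Finset.filter_nonempty_iff]
  simp

/-- Split off the last edge, which membership in a set of level `n` does not see. The coefficients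
are general because the identity serves both path counts and real weights. -/
theorem sum_prefix_succ {R : Type*} [CommSemiring R] {n : ℕ} {U : Set B.PathSpace}
    [DecidablePred (· ∈ U)] (hU : IsLevel n U) (g : B.V → R) :
    ∑ r : B.Prefix (n + 1), (if r.path ∈ U then g r.endpoint else 0) =
      ∑ q : B.Prefix n, if q.path ∈ U then ∑ v, (B.incidence q.endpoint v : R) * g v else 0 := by
  rw [← (prefixSuccEquiv B n).sum_comp, Fintype.sum_sigma]
  refine Finset.sum_congr rfl fun q _ => ?_
  rw [← sum_outEdges]
  have h1 (e : {e : B.E // B.src e = q.endpoint}) :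
      (prefixSuccEquiv B n ⟨q, e⟩).endpoint = B.rng e := by
    simp only [prefixSuccEquiv, Equiv.coe_fn_mk, endpoint_toPrefix, extend_vertex]
  have h2 (e : {e : B.E // B.src e = q.endpoint}) :
      (prefixSuccEquiv B n ⟨q, e⟩).path ∈ U ↔ q.path ∈ U := by
    refine hU.mem_iff ?_
    refine mem_cylinder_trans (extend_mem_cylinder q.path n e.1 e.2) ?_
    exact cylinder_anti _ n.le_succ (path_toPrefix_mem (n + 1) _)
  simp only [h1, h2]
  split_ifs <;> simp

/-- The number of finite paths of length `n + 1` with terminal vertex `w` which start a path in the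
set `U`. -/
noncomputable def levelCount (n : ℕ) (U : Set B.PathSpace) (w : B.V) : ℕ :=
  open Classical in
  (Finset.univ.filter fun q : B.Prefix n => q.endpoint = w ∧ q.path ∈ U).card

variable (B) in
/-- The number of finite paths from the top vertex to the vertex `w` of level `n + 1`. -/
noncomputable def pathCount (n : ℕ) (w : B.V) : ℕ :=
  (Finset.univ.filter fun q : B.Prefix n => q.endpoint = w).card

theorem levelCount_univ (n : ℕ) : levelCount n Set.univ = B.pathCount n := by
  ext w
  simp [levelCount, pathCount]

theorem isLevel_univ (n : ℕ) : IsLevel n (Set.univ : Set B.PathSpace) :=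
  fun _ _ => Set.subset_univ _

theorem levelCount_le_pathCount (n : ℕ) (U : Set B.PathSpace) (w : B.V) :
    levelCount n U w ≤ B.pathCount n w := by
  classical
  refine Finset.card_le_card fun q hq => ?_
  simp only [Finset.mem_filter] at hq ⊢
  exact ⟨hq.1, hq.2.1⟩

theorem sum_prefix_eq_sum_levelCount {R : Type*} [CommSemiring R] (n : ℕ) (U : Set B.PathSpace)
    [DecidablePred (· ∈ U)] (g : B.V → R) :
    ∑ q : B.Prefix n, (if q.path ∈ U then g q.endpoint else 0) =
      ∑ w, (levelCount n U w : R) * g w := by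
  rw [← Finset.sum_fiberwise _ (fun q : B.Prefix n => q.endpoint)]
  refine Finset.sum_congr rfl fun w _ => ?_
  rw [← Finset.sum_filter, Finset.filter_filter,
    Finset.sum_congr rfl (g := fun _ => g w), Finset.sum_const, nsmul_eq_mul]
  · simp only [levelCount]
    congr!
  · intro q hq
    rw [(Finset.mem_filter.1 hq).2.1]

open Matrix in
theorem levelCount_succ {n : ℕ} {U : Set B.PathSpace} (hU : IsLevel n U) :
    levelCount (n + 1) U = levelCount n U ᵥ* B.incidence := by
  classical
  ext v
  -- The indicator of `v` as test function turns the weighted sum into the count at `v`.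
  have h := sum_prefix_succ (R := ℕ) hU (Pi.single v 1)
  have h' := sum_prefix_eq_sum_levelCount (R := ℕ) n U (fun w => B.incidence w v)
  rw [sum_prefix_eq_sum_levelCount] at h
  simp only [Pi.single_apply, mul_ite, mul_one, mul_zero, Finset.sum_ite_eq',
    Finset.mem_univ, if_true, Nat.cast_id] at h h'
  rw [h, h', Matrix.vecMul, dotProduct]

open Matrix in
theorem levelCount_add {n : ℕ} {U : Set B.PathSpace} (hU : IsLevel n U) (m : ℕ) :
    levelCount (n + m) U = levelCount n U ᵥ* B.incidence ^ m := by
  induction m with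
  | zero => simp
  | succ m ih =>
    rw [← add_assoc, levelCount_succ (hU.mono (n.le_add_right m)), ih, Matrix.vecMul_vecMul,
      pow_succ]

open Matrix in
theorem pathCount_add (n m : ℕ) : B.pathCount (n + m) = B.pathCount n ᵥ* B.incidence ^ m := by
  rw [← levelCount_univ, ← levelCount_univ, levelCount_add (isLevel_univ n)]

/-- Among the finite paths starting paths in `U`, one can choose any smaller number for each
terminal vertex. -/
theorem exists_subset_levelCount_eq {n : ℕ} {U : Set B.PathSpace} (hU : IsLevel n U) (k : B.V → ℕ)
    (hk : ∀ w, k w ≤ levelCount n U w) :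
    ∃ W ⊆ U, IsLevel n W ∧ levelCount n W = k := by
  classical
  have h (w : B.V) := Finset.exists_subset_card_eq (hk w)
  choose T hT hTk using h
  have hT' {q : B.Prefix n} {w} (hq : q ∈ T w) : q.endpoint = w ∧ q.path ∈ U := by
    simpa using hT w hq
  refine ⟨{x | x.toPrefix n ∈ T (x.vertex n)}, fun x hx => ?_, fun x hx y hy => ?_, ?_⟩
  · exact (hU.mem_iff (path_toPrefix_mem n x)).1 (hT' hx).2
  · simp only [Set.mem_ofPred_eq] at hx ⊢
    rwa [toPrefix_eq_iff.2 hy, vertex_eq_of_mem hy le_rfl]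
  · ext w
    rw [← hTk w, levelCount]
    congr 1
    ext q
    simp only [Finset.mem_filter, Finset.mem_univ, true_and, Set.mem_ofPred_eq, toPrefix_path]
    exact ⟨fun h => h.1 ▸ h.2, fun h => ⟨(hT' h).1, by rwa [← (hT' h).1] at h⟩⟩

theorem pathCount_zero (w : B.V) :
    B.pathCount 0 w = (Finset.univ.filter fun e : B.E₀ => B.rng₀ e = w).card := by
  refine Finset.card_bij (fun q _ => q.path.first) ?_ ?_ ?_
  · intro q hq
    simpa [PathSpace.rng₀_first] using hq
  · intro q _ r _ h
    rw [← toPrefix_path q, ← toPrefix_path r, toPrefix_eq_iff]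
    exact ⟨h, by simp⟩
  · intro e he
    obtain ⟨x, rfl⟩ := exists_first_eq e
    refine ⟨x.toPrefix 0, ?_, (path_toPrefix_mem 0 x).1⟩
    simpa [← PathSpace.rng₀_first, (path_toPrefix_mem 0 x).1] using he

end StationaryBratteliDiagram

/-! ### Invariant measures and their weights -/

namespace StationaryBratteliDiagram

variable {B : StationaryBratteliDiagram}

open Filter Topology

theorem measure_eq_sum_of_isLevel (μ : Measure B.PathSpace) {n : ℕ} {U : Set B.PathSpace}
    [DecidablePred (· ∈ U)] (hU : IsLevel n U) :
    μ U = ∑ q : B.Prefix n, if q.path ∈ U then μ (cylinder q.path n) else 0 := by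
  have h : U = ⋃ q ∈ Finset.univ.filter (fun q : B.Prefix n => q.path ∈ U),
      cylinder q.path n := by
    ext x
    simp only [Finset.mem_filter, Finset.mem_univ, true_and, Set.mem_iUnion, exists_prop]
    constructor
    · exact fun hx => ⟨x.toPrefix n, hU x hx (path_toPrefix_mem n x),
        mem_cylinder_comm.1 (path_toPrefix_mem n x)⟩
    · exact fun ⟨q, hq, hx⟩ => hU _ hq hx
  conv_lhs => rw [h]
  rw [measure_biUnion_finset, Finset.sum_filter]
  · intro q _ r _ hqr
    refine Set.disjoint_left.2 fun x hx hx' => hqr ?_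
    rw [← toPrefix_path q, ← toPrefix_path r, toPrefix_eq_iff]
    exact mem_cylinder_trans hx' (mem_cylinder_comm.1 hx)
  · exact fun q _ => measurableSet_cylinder _ _

theorem measure_ext_cylinder {μ ν : Measure B.PathSpace} [IsFiniteMeasure μ]
    (h : ∀ x n, μ (cylinder x n) = ν (cylinder x n)) : μ = ν := by
  classical
  refine ext_of_generate_finite _
    ((BorelSpace.measurable_eq (α := B.PathSpace)).trans
      isTopologicalBasis_cylinder.borel_eq_generateFrom) ?_ ?_ ?_
  · rintro _ ⟨x, m, rfl⟩ _ ⟨y, n, rfl⟩ ⟨z, hx, hy⟩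
    rcases le_total m n with hmn | hmn
    · exact ⟨z, n, cylinder_inter_of_mem hmn hx hy⟩
    · exact ⟨z, m, by rw [Set.inter_comm, cylinder_inter_of_mem hmn hy hx]⟩
  · rintro _ ⟨x, n, rfl⟩
    exact h x n
  · rw [measure_eq_sum_of_isLevel μ (isLevel_univ 0), measure_eq_sum_of_isLevel ν (isLevel_univ 0)]
    simp [h]

/-- Whether a path belongs to `S` depends only on its edges from level `n + 1` on. -/
def IsTailSet (n : ℕ) (S : Set B.PathSpace) : Prop :=
  ∀ x y : B.PathSpace, (∀ i ≥ n, x.edge i = y.edge i) → x ∈ S → y ∈ S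

theorem IsTailSet.mono {m n : ℕ} {S : Set B.PathSpace} (h : IsTailSet n S) (hmn : m ≤ n) :
    IsTailSet m S := fun x y hxy => h x y fun i hi => hxy i (hmn.trans hi)

theorem isTailSet_univ (n : ℕ) : IsTailSet n (Set.univ : Set B.PathSpace) :=
  fun _ _ _ _ => Set.mem_univ _

/-- Replace the initial segment of `z` by the one of `y`, if possible. -/
noncomputable def replacePrefix (y : B.PathSpace) (n : ℕ) (z : B.PathSpace) : B.PathSpace :=
  open Classical in
  if h : z.vertex n = y.vertex n then
    splice y n (fun i => z.edge (n + i)) h (fun i => z.rng_edge (n + i)) else z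

theorem replacePrefix_mem {y z : B.PathSpace} {n : ℕ} (h : z.vertex n = y.vertex n) :
    replacePrefix y n z ∈ cylinder y n := by
  rw [replacePrefix, dif_pos h]
  exact splice_mem_cylinder _ _ _ _ _

theorem replacePrefix_edge (y z : B.PathSpace) {n i : ℕ} (hi : n ≤ i) :
    (replacePrefix y n z).edge i = z.edge i := by
  rw [replacePrefix]
  split_ifs with h
  · exact (splice_edge_ge _ _ _ _ hi).trans (by simp only [Nat.add_sub_cancel' hi])
  · rfl

/-- Which branch of the definition applies is decided at level `n`, and later edges are unchanged,
so the preimage of a cylinder of level `m` has level `max n m`. -/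
theorem continuous_replacePrefix (y : B.PathSpace) (n : ℕ) : Continuous (replacePrefix y n) := by
  rw [isTopologicalBasis_cylinder.continuous_iff]
  rintro _ ⟨c, m, rfl⟩
  refine IsLevel.isOpen (n := max n m) fun z hz z' hz' => mem_cylinder_trans hz ?_
  have hv := vertex_eq_of_mem hz' (le_max_left n m)
  by_cases h : z.vertex n = y.vertex n
  · have h1 := replacePrefix_mem h
    have h2 := replacePrefix_mem (hv.trans h)
    refine ⟨h2.1.trans h1.1.symm, fun i hi => ?_⟩
    rcases lt_or_ge i n with hin | hin
    · rw [h1.2 i hin, h2.2 i hin]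
    · rw [replacePrefix_edge _ _ hin, replacePrefix_edge _ _ hin,
        hz'.2 i (hi.trans_le (le_max_right _ _))]
  · have h' : ¬ z'.vertex n = y.vertex n := by rwa [hv]
    rw [replacePrefix, replacePrefix, dif_neg h, dif_neg h']
    exact cylinder_anti _ (le_max_right _ _) hz'

/-- Exchanging initial segments carries `μ` on one cylinder to `μ` on the other: this can be checked
on cylinders, where it is the invariance hypothesis. A tail set is preserved by the exchange, so
invariance extends to intersections with Borel tail sets. -/
theorem measure_cylinder_inter_eq {μ : Measure B.PathSpace} [IsFiniteMeasure μ]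
    (hμ : IsTailInvariant μ) {n : ℕ} {S : Set B.PathSpace} (hS : MeasurableSet S)
    (hSn : IsTailSet n S) {x y : B.PathSpace} (h : x.vertex n = y.vertex n) :
    μ (cylinder x n ∩ S) = μ (cylinder y n ∩ S) := by
  have hφ : Measurable (replacePrefix y n) := (continuous_replacePrefix y n).measurable
  have key : (μ.restrict (cylinder x n)).map (replacePrefix y n) = μ.restrict (cylinder y n) := by
    refine measure_ext_cylinder fun c m => ?_
    rw [Measure.map_apply hφ (measurableSet_cylinder c m),
      Measure.restrict_apply (hφ (measurableSet_cylinder c m)),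
      Measure.restrict_apply (measurableSet_cylinder c m)]
    by_cases hne : (cylinder c m ∩ cylinder y n).Nonempty
    · obtain ⟨d, hdc, hdy⟩ := hne
      have hdx : d.vertex n = x.vertex n := (vertex_eq_of_mem hdy le_rfl).trans h.symm
      have h1 : cylinder c m ∩ cylinder y n = cylinder d (max m n) := by
        rcases le_total m n with hmn | hmn
        · rw [cylinder_inter_of_mem hmn hdc hdy, max_eq_right hmn]
        · rw [Set.inter_comm, cylinder_inter_of_mem hmn hdy hdc, max_eq_left hmn]
      have hd' := replacePrefix_mem hdx
      have h2 : replacePrefix y n ⁻¹' cylinder c m ∩ cylinder x n =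
          cylinder (replacePrefix x n d) (max m n) := by
        ext z
        constructor
        · rintro ⟨hz, hzx⟩
          refine ⟨hzx.1.trans hd'.1.symm, fun i hi => ?_⟩
          rcases lt_or_ge i n with hin | hin
          · rw [hzx.2 i hin, hd'.2 i hin]
          · have him : i < m := (lt_max_iff.1 hi).resolve_right hin.not_gt
            rw [replacePrefix_edge _ _ hin, hdc.2 i him, ← hz.2 i him, replacePrefix_edge _ _ hin]
        · intro hz
          have hzx : z ∈ cylinder x n :=
            mem_cylinder_trans hd' (cylinder_anti _ (le_max_right _ _) hz)
          refine ⟨?_, hzx⟩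
          have hy := replacePrefix_mem ((vertex_eq_of_mem hzx le_rfl).trans h)
          refine ⟨?_, fun i hi => ?_⟩
          · rw [hy.1, ← hdy.1, hdc.1]
          · rcases lt_or_ge i n with hin | hin
            · rw [hy.2 i hin, ← hdy.2 i hin, hdc.2 i hi]
            · rw [replacePrefix_edge _ _ hin, hz.2 i (hi.trans_le (le_max_left _ _)),
                replacePrefix_edge _ _ hin, hdc.2 i hi]
      rw [h1, h2]
      refine hμ _ _ _ ?_
      rw [PathSpace.vertex, PathSpace.vertex, replacePrefix_edge _ _ (le_max_right _ _)]
    · have : replacePrefix y n ⁻¹' cylinder c m ∩ cylinder x n = ∅ := by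
        refine Set.eq_empty_of_forall_notMem fun z hz => hne ⟨_, hz.1, replacePrefix_mem ?_⟩
        exact (vertex_eq_of_mem hz.2 le_rfl).trans h
      rw [this, Set.not_nonempty_iff_eq_empty.1 hne]
  have h3 : μ (cylinder y n ∩ S) = (μ.restrict (cylinder y n)) S := by
    rw [Measure.restrict_apply hS, Set.inter_comm]
  rw [h3, ← key, Measure.map_apply hφ hS, Measure.restrict_apply (hφ hS), Set.inter_comm]
  congr 1
  ext z
  have hz := fun i (hi : i ≥ n) => replacePrefix_edge y z hi
  simp only [Set.mem_inter_iff, Set.mem_preimage]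
  exact and_congr_left fun _ => ⟨hSn _ _ fun i hi => (hz i hi).symm, hSn _ _ hz⟩

/-- The measure of the part in `S` of a cylinder given by a finite path to the vertex `w` of level
`n + 1`. -/
noncomputable def weight (μ : Measure B.PathSpace) (S : Set B.PathSpace) (n : ℕ) (w : B.V) : ℝ :=
  μ.real (cylinder (exists_vertex_eq n w).choose n ∩ S)

theorem weight_nonneg (μ : Measure B.PathSpace) (S : Set B.PathSpace) (n : ℕ) (w : B.V) :
    0 ≤ weight μ S n w := measureReal_nonneg

section weight

variable {μ : Measure B.PathSpace} [IsFiniteMeasure μ] (hμ : IsTailInvariant μ)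
  {S : Set B.PathSpace} (hS : MeasurableSet S)

include hμ hS

theorem real_cylinder_inter {n : ℕ} (hSn : IsTailSet n S) (x : B.PathSpace) :
    μ.real (cylinder x n ∩ S) = weight μ S n (x.vertex n) := by
  rw [weight, Measure.real, Measure.real, measure_cylinder_inter_eq hμ hS hSn]
  exact (exists_vertex_eq n (x.vertex n)).choose_spec.symm

theorem real_inter_of_isLevel {n : ℕ} (hSn : IsTailSet n S) {U : Set B.PathSpace}
    (hU : IsLevel n U) : μ.real (U ∩ S) = ∑ w, (levelCount n U w : ℝ) * weight μ S n w := by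
  classical
  rw [← sum_prefix_eq_sum_levelCount, Measure.real, ← Measure.restrict_apply hU.isOpen.measurableSet,
    measure_eq_sum_of_isLevel _ hU, ENNReal.toReal_sum (by intros; split_ifs <;> simp)]
  refine Finset.sum_congr rfl fun q _ => ?_
  split_ifs
  · rw [Measure.restrict_apply (measurableSet_cylinder _ _), ← real_cylinder_inter hμ hS hSn]
    rfl
  · rfl

theorem weight_succ {n : ℕ} (hSn : IsTailSet (n + 1) S) (w : B.V) :
    weight μ S n w = ∑ v, (B.incidence w v : ℝ) * weight μ S (n + 1) v := by
  classical
  obtain ⟨x, rfl⟩ := exists_vertex_eq n w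
  rw [← real_cylinder_inter hμ hS (hSn.mono n.le_succ),
    real_inter_of_isLevel hμ hS hSn ((isLevel_cylinder x n).mono n.le_succ),
    ← sum_prefix_eq_sum_levelCount, sum_prefix_succ (isLevel_cylinder x n),
    Finset.sum_eq_single_of_mem (x.toPrefix n) (Finset.mem_univ _),
    if_pos (path_toPrefix_mem n x), endpoint_toPrefix]
  intro q _ hq
  refine if_neg fun h => hq ?_
  rw [← toPrefix_path q, toPrefix_eq_iff]
  exact h

open Matrix in
theorem weight_add {n m : ℕ} (hSn : IsTailSet (n + m) S) :
    weight μ S n = (B.incidence ^ m).map (Nat.cast : ℕ → ℝ) *ᵥ weight μ S (n + m) := by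
  induction m with
  | zero => simp
  | succ m ih =>
    have h : weight μ S (n + m) =
        B.incidence.map (Nat.cast : ℕ → ℝ) *ᵥ weight μ S (n + (m + 1)) := by
      ext w
      exact weight_succ hμ hS hSn w
    rw [ih (hSn.mono (by omega)), h, Matrix.mulVec_mulVec, pow_succ]
    congr 1
    exact (Matrix.map_mul (f := Nat.castRingHom ℝ)).symm

end weight

/-- Only levels divisible by `p` are needed, since a set of level `n` also has level `p * n`.
Conversely any vector bounded by the path counts is realised by choosing finite paths. -/
theorem clopenValues_eq {μ : Measure B.PathSpace} [IsFiniteMeasure μ] (hμ : IsTailInvariant μ)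
    {p : ℕ} (hp : 0 < p) :
    clopenValues μ = {a | ∃ (j : ℕ) (k : B.V → ℕ), (∀ w, k w ≤ B.pathCount (p * j) w) ∧
      ∑ w, (k w : ℝ) * weight μ Set.univ (p * j) w = a} := by
  ext a
  constructor
  · rintro ⟨U, hU, rfl⟩
    obtain ⟨n, hn⟩ := exists_isLevel_of_isClopen hU
    refine ⟨n, levelCount (p * n) U, levelCount_le_pathCount _ _, ?_⟩
    rw [← real_inter_of_isLevel hμ .univ (isTailSet_univ _)
      (hn.mono (Nat.le_mul_of_pos_left n hp)), Set.inter_univ]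
  · rintro ⟨j, k, hk, rfl⟩
    obtain ⟨W, -, hW, rfl⟩ := exists_subset_levelCount_eq (isLevel_univ (p * j)) k
      (by rwa [levelCount_univ])
    refine ⟨W, hW.isClopen, ?_⟩
    rw [← real_inter_of_isLevel hμ .univ (isTailSet_univ _) hW, Set.inter_univ]

/-- Approximate by atomic measures `F n` with mass `z n` on one path per finite path. By the
recursion they already have the right value on a cylinder of level at most `n`. Compactness of the
probability measures supplies a limit along an ultrafilter, and cylinders have empty frontier, so
their values pass to the limit. -/
theorem exists_measure_real_cylinder_eq (z : ℕ → B.V → ℝ) (h0 : ∀ n w, 0 ≤ z n w)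
    (hz : ∀ n w, z n w = ∑ v, (B.incidence w v : ℝ) * z (n + 1) v)
    (h1 : ∑ w, (B.pathCount 0 w : ℝ) * z 0 w = 1) :
    ∃ ν : Measure B.PathSpace, IsProbabilityMeasure ν ∧
      ∀ x n, ν (cylinder x n) = ENNReal.ofReal (z n (x.vertex n)) := by
  classical
  let F (n : ℕ) : Measure B.PathSpace :=
    ∑ q : B.Prefix n, ENNReal.ofReal (z n q.endpoint) • Measure.dirac q.path
  have hF (m n : ℕ) (hmn : m ≤ n) (U : Set B.PathSpace) (hU : IsLevel m U) :
      F n U = ENNReal.ofReal (∑ q : B.Prefix m, if q.path ∈ U then z m q.endpoint else 0) := by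
    have h : F n U =
        ENNReal.ofReal (∑ q : B.Prefix n, if q.path ∈ U then z n q.endpoint else 0) := by
      rw [ENNReal.ofReal_sum_of_nonneg (by intros; split_ifs <;> simp [h0])]
      simp only [F, Measure.coe_finsetSum, Finset.sum_apply, Measure.smul_apply, smul_eq_mul]
      refine Finset.sum_congr rfl fun q _ => ?_
      rw [Measure.dirac_apply' _ hU.isOpen.measurableSet]
      by_cases hq : q.path ∈ U <;> simp [hq]
    rw [h]
    congr 1
    clear h
    induction n, hmn using Nat.le_induction with
    | base => rfl
    | succ n hmn ih =>
      rw [sum_prefix_succ (hU.mono hmn) (z (n + 1)), ← ih]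
      simp only [hz n]
  have hF1 (n : ℕ) : IsProbabilityMeasure (F n) := by
    refine ⟨?_⟩
    have h2 := sum_prefix_eq_sum_levelCount 0 Set.univ (z 0)
    rw [levelCount_univ, h1] at h2
    rw [hF 0 n n.zero_le Set.univ (isLevel_univ 0), ← ENNReal.ofReal_one, ← h2]
    simp
  let P (n : ℕ) : ProbabilityMeasure B.PathSpace := ⟨F n, hF1 n⟩
  let L : Ultrafilter ℕ := Ultrafilter.of atTop
  have hL : (L : Filter ℕ) ≤ atTop := Ultrafilter.of_le _
  have hlim : Tendsto P L (𝓝 (L.map P).lim) := (L.map P).le_nhds_lim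
  refine ⟨((L.map P).lim : ProbabilityMeasure B.PathSpace), inferInstance, fun x n => ?_⟩
  have h := ProbabilityMeasure.tendsto_measure_of_null_frontier_of_tendsto' hlim
    (E := cylinder x n) (by rw [(isClopen_cylinder x n).frontier_eq]; simp)
  refine tendsto_nhds_unique h (tendsto_const_nhds.congr' ?_)
  filter_upwards [hL (eventually_ge_atTop n)] with m hm
  change _ = F m (cylinder x n)
  rw [hF n m hm _ (isLevel_cylinder x n),
    Finset.sum_eq_single_of_mem (x.toPrefix n) (Finset.mem_univ _),
    if_pos (path_toPrefix_mem n x), endpoint_toPrefix]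
  intro q _ hq
  refine if_neg fun h => hq ?_
  rw [← toPrefix_path q, toPrefix_eq_iff]
  exact h

end StationaryBratteliDiagram

/-! ### Contraction by stochastic matrices and uniqueness of positive solutions -/

section Contraction

variable {ι : Type*} [Fintype ι]

/-- Doeblin's argument: all rows share mass `δ` at the index `a`, so both ends of the interval of
values move towards `f a` by the fraction `δ`. -/
theorem exists_bounds_stochastic {P : ι → ι → ℝ} (hP : ∀ w v, 0 ≤ P w v) (hP1 : ∀ w, ∑ v, P w v = 1)
    {δ : ℝ} {a : ι} (ha : ∀ w, δ ≤ P w a) {f : ι → ℝ} {m M : ℝ} (hm : ∀ w, m ≤ f w)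
    (hM : ∀ w, f w ≤ M) :
    ∃ m' M', M' - m' = (1 - δ) * (M - m) ∧
      ∀ w, m' ≤ ∑ v, P w v * f v ∧ ∑ v, P w v * f v ≤ M' := by
  refine ⟨m + δ * (f a - m), M - δ * (M - f a), by ring, fun w => ⟨?_, ?_⟩⟩
  · have h : ∑ v, P w v * f v = m + ∑ v, P w v * (f v - m) := by
      simp only [mul_sub, Finset.sum_sub_distrib, ← Finset.sum_mul, hP1]
      ring
    have h1 : P w a * (f a - m) ≤ ∑ v, P w v * (f v - m) :=
      Finset.single_le_sum (f := fun v => P w v * (f v - m))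
        (fun v _ => mul_nonneg (hP w v) (sub_nonneg.2 (hm v))) (Finset.mem_univ a)
    have h2 := mul_le_mul_of_nonneg_right (ha w) (sub_nonneg.2 (hm a))
    linarith
  · have h : ∑ v, P w v * f v = M - ∑ v, P w v * (M - f v) := by
      simp only [mul_sub, Finset.sum_sub_distrib, ← Finset.sum_mul, hP1]
      ring
    have h1 : P w a * (M - f a) ≤ ∑ v, P w v * (M - f v) :=
      Finset.single_le_sum (f := fun v => P w v * (M - f v))
        (fun v _ => mul_nonneg (hP w v) (sub_nonneg.2 (hM v))) (Finset.mem_univ a)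
    have h2 := mul_le_mul_of_nonneg_right (ha w) (sub_nonneg.2 (hM a))
    linarith

theorem exists_osc_le {P : ι → ι → ℝ} (hP : ∀ w v, 0 ≤ P w v) (hP1 : ∀ w, ∑ v, P w v = 1)
    {δ : ℝ} {a : ι} (ha : ∀ w, δ ≤ P w a) {f : ℕ → ι → ℝ}
    (hf : ∀ n w, f (n + 1) w = ∑ v, P w v * f n v) :
    ∃ D, ∀ n w w', f n w - f n w' ≤ (1 - δ) ^ n * D := by
  let K := ∑ w, |f 0 w|
  have hK (w : ι) : |f 0 w| ≤ K :=
    Finset.single_le_sum (f := fun w => |f 0 w|) (fun _ _ => abs_nonneg _) (Finset.mem_univ w)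
  have h : ∀ n, ∃ m M, M - m = (1 - δ) ^ n * (K + K) ∧ ∀ w, m ≤ f n w ∧ f n w ≤ M := by
    intro n
    induction n with
    | zero => exact ⟨-K, K, by ring, fun w => abs_le.1 (hK w)⟩
    | succ n ih =>
      obtain ⟨m, M, hmM, hb⟩ := ih
      obtain ⟨m', M', h, hb'⟩ := exists_bounds_stochastic hP hP1 ha (fun w => (hb w).1)
        (fun w => (hb w).2)
      exact ⟨m', M', by rw [h, hmM]; ring, fun w => by rw [hf]; exact hb' w⟩
  refine ⟨K + K, fun n w w' => ?_⟩
  obtain ⟨m, M, h, hb⟩ := h n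
  linarith [(hb w).2, (hb w').1]

/-- Here averaging runs backwards: `f n` is obtained from `f (n + k)` by `k` contractions, and `f (n
+ k)` lies in `[0, K]`. Letting `k` grow shows that each `f n` is constant, and then row sums 1 make
the constant independent of `n`. -/
theorem forall_eq_of_stochastic {P : ℕ → ι → ι → ℝ} (hP1 : ∀ n w, ∑ v, P n w v = 1)
    {δ : ℝ} (hδ : 0 < δ) (hPδ : ∀ n w v, δ ≤ P n w v) {f : ℕ → ι → ℝ}
    (hf : ∀ n w, f n w = ∑ v, P n w v * f (n + 1) v) {K : ℝ} (h0 : ∀ n w, 0 ≤ f n w)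
    (hK : ∀ n w, f n w ≤ K) (n n' : ℕ) (w w' : ι) : f n w = f n' w' := by
  have h : ∀ k n, ∃ m M, M - m = (1 - δ) ^ k * K ∧ ∀ w, m ≤ f n w ∧ f n w ≤ M := by
    intro k
    induction k with
    | zero => exact fun n => ⟨0, K, by ring, fun w => ⟨h0 n w, hK n w⟩⟩
    | succ k ih =>
      intro n
      obtain ⟨m, M, hmM, hb⟩ := ih (n + 1)
      obtain ⟨m', M', h, hb'⟩ := exists_bounds_stochastic (fun w v => hδ.le.trans (hPδ n w v))
        (hP1 n) (fun u => hPδ n u w) (fun w => (hb w).1) (fun w => (hb w).2)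
      exact ⟨m', M', by rw [h, hmM]; ring, fun w => by rw [hf]; exact hb' w⟩
  have hδ1 : δ ≤ 1 := by
    rw [← hP1 0 w]
    exact (hPδ 0 w w).trans (Finset.single_le_sum
      (fun v _ => hδ.le.trans (hPδ 0 w v)) (Finset.mem_univ w))
  have hlim : Filter.Tendsto (fun k : ℕ => (1 - δ) ^ k * K) Filter.atTop (nhds 0) := by
    simpa using (tendsto_pow_atTop_nhds_zero_of_lt_one (sub_nonneg.2 hδ1)
      (sub_lt_self 1 hδ)).mul_const K
  have hle (n : ℕ) (u u' : ι) : f n u ≤ f n u' := by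
    refine sub_nonpos.1 (ge_of_tendsto' hlim fun k => ?_)
    obtain ⟨m, M, h, hb⟩ := h k n
    linarith [(hb u).2, (hb u').1]
  have hc (n : ℕ) (u u' : ι) : f n u = f n u' := le_antisymm (hle n u u') (hle n u' u)
  have hs (n : ℕ) : f n w = f 0 w := by
    induction n with
    | zero => rfl
    | succ n ih =>
      rw [← ih, hf n w, Finset.sum_congr rfl fun v _ => by rw [hc (n + 1) v w],
        ← Finset.sum_mul, hP1, one_mul]
  rw [hs n, hc n' w' w, hs n']

/-- For a matrix with positive entries, the non-negative sequences `u` with `u n = C u (n + 1)` form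
a ray. -/
theorem exists_eq_mul_of_pos {C : ι → ι → ℝ} (hC : ∀ w v, 0 < C w v) {u v : ℕ → ι → ℝ}
    (hu0 : ∀ n w, 0 ≤ u n w) (hv0 : ∀ n w, 0 < v n w)
    (hu : ∀ n w, u n w = ∑ w', C w w' * u (n + 1) w')
    (hv : ∀ n w, v n w = ∑ w', C w w' * v (n + 1) w') :
    ∃ c, 0 ≤ c ∧ ∀ n w, u n w = c * v n w := by
  rcases isEmpty_or_nonempty ι with hι | hι
  · exact ⟨0, le_rfl, fun _ w => isEmptyElim w⟩
  have w₀ : ι := Classical.arbitrary ι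
  obtain ⟨c₀, hc₀, hcC⟩ : ∃ c₀ > 0, ∀ w v, c₀ ≤ C w v := by
    obtain ⟨p, hp⟩ := Finite.exists_min fun p : ι × ι => C p.1 p.2
    exact ⟨C p.1 p.2, hC _ _, fun w v => hp (w, v)⟩
  obtain ⟨c₁, hc₁, hCc⟩ : ∃ c₁ > 0, ∀ w v, C w v ≤ c₁ := by
    obtain ⟨p, hp⟩ := Finite.exists_max fun p : ι × ι => C p.1 p.2
    exact ⟨C p.1 p.2, hC _ _, fun w v => hp (w, v)⟩
  have hlo {z : ℕ → ι → ℝ} (hz0 : ∀ n w, 0 ≤ z n w)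
      (hz : ∀ n w, z n w = ∑ w', C w w' * z (n + 1) w') (n w) :
      c₀ * ∑ w', z (n + 1) w' ≤ z n w := by
    rw [hz, Finset.mul_sum]
    exact Finset.sum_le_sum fun v _ => mul_le_mul_of_nonneg_right (hcC w v) (hz0 _ _)
  have hhi {z : ℕ → ι → ℝ} (hz0 : ∀ n w, 0 ≤ z n w)
      (hz : ∀ n w, z n w = ∑ w', C w w' * z (n + 1) w') (n w) :
      z n w ≤ c₁ * ∑ w', z (n + 1) w' := by
    rw [hz, Finset.mul_sum]
    exact Finset.sum_le_sum fun v _ => mul_le_mul_of_nonneg_right (hCc w v) (hz0 _ _)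
  -- Bounds on the entries of `C` make the coordinates of any solution comparable, uniformly in `n`.
  have hbal {z : ℕ → ι → ℝ} (hz0 : ∀ n w, 0 ≤ z n w)
      (hz : ∀ n w, z n w = ∑ w', C w w' * z (n + 1) w') (n w w') :
      c₀ * z n w ≤ c₁ * z n w' := by
    have h1 := mul_le_mul_of_nonneg_left (hhi hz0 hz n w) hc₀.le
    have h2 := mul_le_mul_of_nonneg_left (hlo hz0 hz n w') hc₁.le
    linarith
  have hv0' := fun n w => (hv0 n w).le
  -- Dividing by the positive solution `v` turns `C` into the stochastic matrices `P n`, and `u`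
  -- into a function that they average.
  let f (n : ℕ) (w : ι) := u n w / v n w
  let P (n : ℕ) (w w' : ι) := C w w' * v (n + 1) w' / v n w
  have hf0 (n w) : 0 ≤ f n w := div_nonneg (hu0 n w) (hv0' n w)
  have hf (n w) : f n w = ∑ w', P n w w' * f (n + 1) w' := by
    simp only [f, P]
    rw [hu n w, Finset.sum_div]
    refine Finset.sum_congr rfl fun w' _ => ?_
    have := (hv0 (n + 1) w').ne'
    field_simp
  have hP1 (n w) : ∑ w', P n w w' = 1 := by
    simp only [P]
    rw [← Finset.sum_div, ← hv, div_self (hv0 n w).ne']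
  have hfbal (n w w') : f n w ≤ (c₁ / c₀) ^ 2 * f n w' := by
    have h1 := hbal hu0 hu n w w'
    have h2 := hbal hv0' hv n w' w
    have h3 := mul_le_mul h1 h2 (mul_nonneg hc₀.le (hv0' n w')) (mul_nonneg hc₁.le (hu0 n w'))
    have := hv0 n w
    have := hv0 n w'
    simp only [f]
    rw [div_pow, div_mul_div_comm, div_le_div_iff₀ (hv0 n w) (by positivity)]
    linarith
  -- Minimum principle: lower bounds pass back to time 0. With `hfbal` this bounds every value by a
  -- fixed multiple of `f 0 w₀`.
  have hfmin (r : ℝ) (n) : (∀ w, r ≤ f n w) → ∀ w, r ≤ f 0 w := by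
    induction n with
    | zero => exact id
    | succ n ih =>
      refine fun h => ih fun w => ?_
      rw [hf n w, ← mul_one r, ← hP1 n w, Finset.mul_sum]
      refine Finset.sum_le_sum fun w' _ => ?_
      rw [mul_comm]
      exact mul_le_mul_of_nonneg_left (h w')
        (div_nonneg (mul_nonneg (hC _ _).le (hv0' _ _)) (hv0' _ _))
  have hfK (n w) : f n w ≤ (c₁ / c₀) ^ 2 * f 0 w₀ := by
    have hpos : 0 < (c₁ / c₀) ^ 2 := by positivity
    have h := hfmin (f n w / (c₁ / c₀) ^ 2) n (fun w' => (div_le_iff₀' hpos).2 (hfbal n w w')) w₀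
    exact (div_le_iff₀' hpos).1 h
  have hcard : (0 : ℝ) < Fintype.card ι := Nat.cast_pos.2 Fintype.card_pos
  have hPδ (n w w') : c₀ ^ 2 / (c₁ ^ 2 * Fintype.card ι) ≤ P n w w' := by
    have hsum : ∑ y, v (n + 1) y ≤ Fintype.card ι * (c₁ / c₀ * v (n + 1) w') := by
      rw [← nsmul_eq_mul, ← Finset.card_univ]
      refine Finset.sum_le_card_nsmul _ _ _ fun y _ => ?_
      rw [div_mul_eq_mul_div, le_div_iff₀' hc₀]
      exact hbal hv0' hv _ _ _
    have h1 : v n w ≤ c₁ * (Fintype.card ι * (c₁ / c₀ * v (n + 1) w')) :=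
      (hhi hv0' hv n w).trans (mul_le_mul_of_nonneg_left hsum hc₁.le)
    simp only [P]
    rw [div_le_div_iff₀ (by positivity) (hv0 n w)]
    calc c₀ ^ 2 * v n w ≤ c₀ ^ 2 * (c₁ * (Fintype.card ι * (c₁ / c₀ * v (n + 1) w'))) := by
          gcongr
      _ = c₀ * v (n + 1) w' * (c₁ ^ 2 * Fintype.card ι) := by field_simp
      _ ≤ _ := by
        have := hv0' (n + 1) w'
        have := hcC w w'
        gcongr
  refine ⟨f 0 w₀, hf0 0 w₀, fun n w => ?_⟩
  rw [← forall_eq_of_stochastic hP1 (by positivity) hPδ hf hf0 hfK n 0 w w₀]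
  exact (div_mul_cancel₀ _ (hv0 n w).ne').symm

end Contraction

/-- An eigenvector `x` of the non-negative matrix `A`, with eigenvalue `l > 1`, which is supported on
the indices leading to the class `α`, and `α` is the set of positive indices reached from `α`. -/
structure IsDistinguished {V : Type*} [Fintype V] (A : Matrix V V ℕ) (x : V → ℝ) (l : ℝ)
    (α : Set V) : Prop where
  one_lt : 1 < l
  nonneg : ∀ w, 0 ≤ x w
  eigen : ∀ w, ∑ v, (A w v : ℝ) * x v = l * x w
  nonempty : α.Nonempty
  pos_of_mem : ∀ a ∈ α, 0 < x a
  reach : ∀ w, 0 < x w → ∀ a ∈ α, A w a ≠ 0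
  closed : ∀ a ∈ α, ∀ v, A a v ≠ 0 → 0 < x v → v ∈ α
  column : ∀ v, ∃ w, A w v ≠ 0

/-- The row vector `k A ^ n`. -/
def Matrix.pushRow {V : Type*} [Fintype V] (A : Matrix V V ℕ) (k : V → ℤ) : ℕ → V → ℤ
  | 0 => k
  | n + 1 => fun v => ∑ w, A.pushRow k n w * A w v

/-! ### Distinguished eigenvectors: growth of row vectors on the class -/

namespace IsDistinguished

variable {V : Type*} [Fintype V] {A : Matrix V V ℕ} {x : V → ℝ} {l : ℝ} {α : Set V}

section

variable (h : IsDistinguished A x l α)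

include h

theorem pos : 0 < l := one_pos.trans h.one_lt

theorem pos_of_entry {w v : V} (hA : A w v ≠ 0) (hv : 0 < x v) : 0 < x w := by
  have h1 : (A w v : ℝ) * x v ≤ l * x w := by
    rw [← h.eigen]
    exact Finset.single_le_sum (f := fun v => (A w v : ℝ) * x v)
      (fun v _ => mul_nonneg (Nat.cast_nonneg _) (h.nonneg v)) (Finset.mem_univ v)
  have h2 : 0 < (A w v : ℝ) * x v := mul_pos (Nat.cast_pos.2 (Nat.pos_of_ne_zero hA)) hv
  exact (mul_pos_iff_of_pos_left h.pos).1 (h2.trans_le h1)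

theorem sum_pushRow (k : V → ℤ) (n : ℕ) :
    ∑ v, (A.pushRow k n v : ℝ) * x v = l ^ n * ∑ v, (k v : ℝ) * x v := by
  induction n with
  | zero => simp [Matrix.pushRow]
  | succ n ih =>
    rw [pow_succ', mul_assoc, ← ih, Finset.mul_sum]
    simp only [Matrix.pushRow, Int.cast_sum, Int.cast_mul, Int.cast_natCast, Finset.sum_mul]
    rw [Finset.sum_comm]
    refine Finset.sum_congr rfl fun w _ => ?_
    rw [mul_left_comm, ← h.eigen, Finset.mul_sum]
    exact Finset.sum_congr rfl fun v _ => mul_assoc _ _ _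

/-- By `closed`, a positive index outside `α` receives only from positive indices outside `α`, so
the entries on `α` never interfere. As no column vanishes, at least one summand is `≥ c`. -/
theorem le_pushRow {k : V → ℤ} {c : ℤ} (hc : 0 ≤ c) (hk : ∀ w, 0 < x w → w ∉ α → c ≤ k w) (n : ℕ)
    (v : V) (hv : 0 < x v) (hvα : v ∉ α) : c ≤ A.pushRow k n v := by
  induction n generalizing v with
  | zero => exact hk v hv hvα
  | succ n ih =>
    have h1 (w : V) (hw : A w v ≠ 0) : c ≤ A.pushRow k n w :=
      ih w (h.pos_of_entry hw hv) fun hwα => hvα (h.closed w hwα v hw hv)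
    have h2 (w : V) : 0 ≤ A.pushRow k n w * A w v := by
      rcases eq_or_ne (A w v) 0 with hw | hw
      · simp [hw]
      · exact mul_nonneg (hc.trans (h1 w hw)) (Int.natCast_nonneg _)
    obtain ⟨u, hu⟩ := h.column v
    calc c ≤ A.pushRow k n u * A u v :=
          (h1 u hu).trans (le_mul_of_one_le_right (hc.trans (h1 u hu))
            (by exact_mod_cast Nat.pos_of_ne_zero hu))
      _ ≤ A.pushRow k (n + 1) v :=
          Finset.single_le_sum (f := fun w => A.pushRow k n w * A w v) (fun w _ => h2 w)
            (Finset.mem_univ u)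

/-- The row vectors `k A ^ n` tend to infinity on the class `α` if `k x > 0`. -/
theorem exists_le_pushRow_of_mem {k : V → ℤ} (hk : 0 < ∑ v, (k v : ℝ) * x v) {a : V} (ha : a ∈ α)
    (M : ℤ) : ∃ N, ∀ n ≥ N, M ≤ A.pushRow k n a := by
  classical
  let S := {w : V // 0 < x w}
  have hl := h.pos
  have hxa := h.pos_of_mem a ha
  have hsumS (F : V → ℝ) (hF : ∀ v, x v = 0 → F v = 0) : ∑ v : S, F v = ∑ v, F v := by
    rw [← Finset.sum_subtype (Finset.univ.filter fun v => 0 < x v) (by simp) F,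
      Finset.sum_filter]
    refine Finset.sum_congr rfl fun v _ => ?_
    split_ifs with hv
    · rfl
    · exact (hF v (le_antisymm (not_lt.1 hv) (h.nonneg v))).symm
  -- `g n w` is the entry `(A ^ n) w a`
  obtain ⟨g, hgzero, hg⟩ : ∃ g : ℕ → V → ℝ, (∀ w, g 0 w = if w = a then 1 else 0) ∧
      ∀ n w, g (n + 1) w = ∑ v, (A w v : ℝ) * g n v :=
    ⟨fun n => Nat.rec (fun w => if w = a then 1 else 0) (fun _ g w => ∑ v, (A w v : ℝ) * g v) n,
      fun _ => rfl, fun _ _ => rfl⟩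
  have hg0 (n : ℕ) : ∀ w, 0 ≤ g n w := by
    induction n with
    | zero => intro w; rw [hgzero]; split_ifs <;> simp
    | succ n ih =>
      intro w
      rw [hg]
      exact Finset.sum_nonneg fun v _ => mul_nonneg (Nat.cast_nonneg _) (ih v)
  have hgx (n : ℕ) : ∀ w, g n w * x a ≤ l ^ n * x w := by
    induction n with
    | zero =>
      intro w
      rw [hgzero]
      split_ifs with hw
      · simp [hw]
      · simpa using h.nonneg w
    | succ n ih =>
      intro w
      rw [hg, pow_succ, mul_assoc, ← h.eigen, Finset.sum_mul, Finset.mul_sum]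
      refine Finset.sum_le_sum fun v _ => ?_
      have := mul_le_mul_of_nonneg_left (ih v) (Nat.cast_nonneg (α := ℝ) (A w v))
      linarith
  have hgz (n w) (hw : x w = 0) : g n w = 0 := by
    have := hgx n w
    rw [hw, mul_zero] at this
    exact le_antisymm (nonpos_of_mul_nonpos_left this hxa) (hg0 n w)
  have hpush (n : ℕ) : ∀ k : V → ℤ, (A.pushRow k n a : ℝ) = ∑ w, (k w : ℝ) * g n w := by
    have key (m : ℕ) : ∀ (k : V → ℤ) (n : ℕ),
        ∑ w, (A.pushRow k (n + m) w : ℝ) * g 0 w = ∑ w, (A.pushRow k n w : ℝ) * g m w := by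
      induction m with
      | zero => intros; rfl
      | succ m ih =>
        intro k n
        rw [← add_assoc, add_right_comm, ih]
        simp only [hg, Matrix.pushRow, Int.cast_sum, Int.cast_mul, Int.cast_natCast,
          Finset.sum_mul, Finset.mul_sum]
        rw [Finset.sum_comm]
        simp only [mul_assoc]
    intro k
    have := key n k 0
    rw [zero_add] at this
    simp only [Matrix.pushRow] at this
    rw [← this]
    simp [hgzero]
  -- Normalising by the eigenvector makes the recursion for `g` an averaging by the stochastic
  -- matrix `P`, on the indices where `x` is positive.
  obtain ⟨f, hfdef⟩ : ∃ f : ℕ → S → ℝ, ∀ n w, f n w = g n w / (l ^ n * x w) := ⟨_, fun _ _ => rfl⟩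
  let P (w v : S) : ℝ := A w v * x v / (l * x w)
  have hP (w v : S) : 0 ≤ P w v :=
    div_nonneg (mul_nonneg (Nat.cast_nonneg _) v.2.le) (mul_pos hl w.2).le
  have hP1 (w : S) : ∑ v, P w v = 1 := by
    simp only [P]
    rw [← Finset.sum_div, hsumS (fun v => (A w v : ℝ) * x v) (fun v hv => by simp [hv]), h.eigen,
      div_self (mul_pos hl w.2).ne']
  let T := ∑ v, x v
  have hT (w : V) : x w ≤ T := Finset.single_le_sum (fun v _ => h.nonneg v) (Finset.mem_univ w)
  have hT0 : 0 < T := hxa.trans_le (hT a)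
  have hAa (w : S) : (1 : ℝ) ≤ A w a :=
    Nat.one_le_cast.2 (Nat.pos_of_ne_zero (h.reach w w.2 a ha))
  -- Every positive index leads to `a`; this is the common mass that the contraction needs.
  have hPa (w : S) : x a / (l * T) ≤ P w ⟨a, hxa⟩ := by
    have hw := w.2
    have h1 := hT w
    have h2 := hAa w
    simp only [P]
    gcongr
    exact le_mul_of_one_le_left hxa.le h2
  have hf (n : ℕ) (w : S) : f (n + 1) w = ∑ v, P w v * f n v := by
    simp only [hfdef, P]
    rw [hg, ← hsumS (fun v => (A w v : ℝ) * g n v) (fun v hv => by rw [hgz n v hv, mul_zero]), Finset.sum_div]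
    refine Finset.sum_congr rfl fun v _ => ?_
    have := v.2.ne'
    have := w.2.ne'
    field_simp
    ring
  -- The bound starts at time 1, because `g 0` vanishes away from `a`.
  have hfc (n : ℕ) : ∀ w, 1 / (l * T) ≤ f (n + 1) w := by
    induction n with
    | zero =>
      intro w
      have hw := w.2
      have h1 := hT w
      have h2 := hAa w
      have h3 : g 1 w = A w a := by simp [hg, hgzero]
      simp only [hfdef, zero_add, h3, pow_one]
      gcongr
    | succ n ih =>
      intro w
      have h1 : 1 / (l * T) = ∑ v, P w v * (1 / (l * T)) := by
        rw [← Finset.sum_mul, hP1, one_mul]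
      rw [hf, h1]
      exact Finset.sum_le_sum fun v _ => mul_le_mul_of_nonneg_left (ih v) (hP w v)
  obtain ⟨D, hD⟩ := exists_osc_le hP hP1 hPa hf
  have hδ1 : x a / (l * T) ≤ 1 := by
    rw [← hP1 ⟨a, hxa⟩]
    exact (hPa _).trans (Finset.single_le_sum (fun v _ => hP _ v) (Finset.mem_univ _))
  have hδ0 : 0 < x a / (l * T) := by positivity
  let s := ∑ v, (k v : ℝ) * x v
  let R := ∑ w : S, |(k w : ℝ) * x w|
  -- Replace each `f (n + 1) w` by its value at `a`: the main term is at least `s / (l * T)`, and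
  -- the error decays geometrically.
  have hlow (n : ℕ) : l ^ (n + 1) * (s * (1 / (l * T)) - R * ((1 - x a / (l * T)) ^ (n + 1) * D)) ≤
      A.pushRow k (n + 1) a := by
    have h1 : (A.pushRow k (n + 1) a : ℝ) =
        l ^ (n + 1) * ∑ w : S, (k w : ℝ) * x w * f (n + 1) w := by
      rw [hpush, ← hsumS (fun v => (k v : ℝ) * g (n + 1) v)
        (fun v hv => by rw [hgz _ v hv, mul_zero]), Finset.mul_sum]
      refine Finset.sum_congr rfl fun w _ => ?_
      have := w.2.ne'
      simp only [hfdef]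
      field_simp
    have h2 : ∑ w : S, (k w : ℝ) * x w = s :=
      hsumS (fun v => (k v : ℝ) * x v) (fun v hv => by simp [hv])
    have h3 : ∑ w : S, (k w : ℝ) * x w * f (n + 1) w = s * f (n + 1) ⟨a, hxa⟩ +
        ∑ w : S, (k w : ℝ) * x w * (f (n + 1) w - f (n + 1) ⟨a, hxa⟩) := by
      simp only [mul_sub, Finset.sum_sub_distrib, ← Finset.sum_mul, h2]
      ring
    have h4 : -(R * ((1 - x a / (l * T)) ^ (n + 1) * D)) ≤
        ∑ w : S, (k w : ℝ) * x w * (f (n + 1) w - f (n + 1) ⟨a, hxa⟩) := by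
      rw [← neg_mul, ← Finset.sum_neg_distrib, Finset.sum_mul]
      refine Finset.sum_le_sum fun w _ => ?_
      have h5 : |f (n + 1) w - f (n + 1) ⟨a, hxa⟩| ≤ (1 - x a / (l * T)) ^ (n + 1) * D :=
        abs_sub_le_iff.2 ⟨hD _ _ _, hD _ _ _⟩
      have h6 := mul_le_mul_of_nonneg_left h5 (abs_nonneg ((k w : ℝ) * x w))
      have h7 := neg_abs_le ((k w : ℝ) * x w * (f (n + 1) w - f (n + 1) ⟨a, hxa⟩))
      rw [abs_mul] at h7
      linarith
    have h8 := mul_le_mul_of_nonneg_left (hfc n ⟨a, hxa⟩) hk.le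
    rw [h1, h3]
    refine mul_le_mul_of_nonneg_left ?_ (by positivity)
    linarith
  have hlim : Filter.Tendsto (fun n : ℕ =>
      s * (1 / (l * T)) - R * ((1 - x a / (l * T)) ^ (n + 1) * D)) Filter.atTop
      (nhds (s * (1 / (l * T)))) := by
    have := (((tendsto_pow_atTop_nhds_zero_of_lt_one (sub_nonneg.2 hδ1)
      (sub_lt_self 1 hδ0)).comp (Filter.tendsto_add_atTop_nat 1)).mul_const D).const_mul R
    simpa using this.const_sub (s * (1 / (l * T)))
  have htop := ((tendsto_pow_atTop_atTop_of_one_lt h.one_lt).comp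
    (Filter.tendsto_add_atTop_nat 1)).atTop_mul_pos (by positivity) hlim
  obtain ⟨N, hN⟩ := Filter.eventually_atTop.1 (htop.eventually_ge_atTop (M : ℝ))
  refine ⟨N + 1, fun n hn => ?_⟩
  obtain ⟨n, rfl⟩ : ∃ n', n = n' + 1 := ⟨n - 1, by omega⟩
  exact_mod_cast (hN n (by omega)).trans (hlow n)

end

end IsDistinguished

/-! ### Rational dependence on the class, and the set of values -/

theorem exists_mul_eq_sum_of_mem_span_rat {V : Type*} [Fintype V] (x : V → ℝ) (α : Set V) {r : ℝ}
    (hr : r ∈ Submodule.span ℚ (x '' α)) :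
    ∃ (m : ℕ) (c : V → ℤ), 0 < m ∧ (∀ v, v ∉ α → c v = 0) ∧ m * r = ∑ v, (c v : ℝ) * x v := by
  classical
  induction hr using Submodule.span_induction with
  | mem r hr =>
    obtain ⟨a, ha, rfl⟩ := hr
    refine ⟨1, Pi.single a 1, one_pos, fun v hv => Pi.single_eq_of_ne (by rintro rfl; exact hv ha) _, ?_⟩
    simp [Pi.single_apply]
  | zero => exact ⟨1, 0, one_pos, fun _ _ => rfl, by simp⟩
  | add r s _ _ hr hs =>
    obtain ⟨m, c, hm, hc, hr⟩ := hr
    obtain ⟨n, d, hn, hd, hs⟩ := hs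
    refine ⟨m * n, fun v => n * c v + m * d v, Nat.mul_pos hm hn, fun v hv => ?_, ?_⟩
    · simp [hc v hv, hd v hv]
    · have h1 : ∑ v, ((n * c v + m * d v : ℤ) : ℝ) * x v =
          n * ∑ v, (c v : ℝ) * x v + m * ∑ v, (d v : ℝ) * x v := by
        rw [Finset.mul_sum, Finset.mul_sum, ← Finset.sum_add_distrib]
        refine Finset.sum_congr rfl fun v _ => ?_
        push_cast
        ring
      rw [h1, ← hr, ← hs]
      push_cast
      ring
  | smul q r _ hr =>
    obtain ⟨m, c, hm, hc, hr⟩ := hr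
    refine ⟨q.den * m, fun v => q.num * c v, Nat.mul_pos q.den_pos hm, fun v hv => by
      simp [hc v hv], ?_⟩
    have h1 : ∑ v, ((q.num * c v : ℤ) : ℝ) * x v = q.num * ∑ v, (c v : ℝ) * x v := by
      rw [Finset.mul_sum]
      refine Finset.sum_congr rfl fun v _ => ?_
      push_cast
      ring
    have h2 : (q.den : ℝ) * q = q.num := by exact_mod_cast Rat.den_mul_eq_num q
    rw [h1, ← hr, ← h2, Rat.smul_def]
    push_cast
    ring

namespace IsDistinguished

variable {V : Type*} [Fintype V] {A : Matrix V V ℕ} {x : V → ℝ} {l : ℝ} {α : Set V}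
  (h : IsDistinguished A x l α)

include h

-- The rational span `U` of the entries on `α` is stable under `l`. The positive entries outside `α`
-- solve the system `(l - C) x = y`, where `C` is the corresponding block of `A` and `y` comes from
-- `α`, so `y` lies in `U`. Cramer's rule puts `det (l - C) * x w` in `U`, and the determinant can
-- then be divided out.
open Polynomial in
theorem mem_span_rat (w : V) : x w ∈ Submodule.span ℚ (x '' α) := by
  classical
  let U := Submodule.span ℚ (x '' α)
  have hα (a : V) (ha : a ∈ α) : x a ∈ U := Submodule.subset_span ⟨a, ha, rfl⟩
  have hnat (n : ℕ) {r : ℝ} (hr : r ∈ U) : (n : ℝ) * r ∈ U := by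
    rw [← nsmul_eq_mul]
    exact U.nsmul_mem hr n
  have hlU {r : ℝ} (hr : r ∈ U) : l * r ∈ U := by
    induction hr using Submodule.span_induction with
    | mem r hr =>
      obtain ⟨a, ha, rfl⟩ := hr
      rw [← h.eigen]
      refine U.sum_mem fun v _ => ?_
      by_cases hv : 0 < x v ∧ A a v ≠ 0
      · exact hnat _ (hα v (h.closed a ha v hv.2 hv.1))
      · rw [not_and_or, not_lt, not_not] at hv
        rcases hv with hv | hv
        · rw [le_antisymm hv (h.nonneg v), mul_zero]
          exact U.zero_mem
        · rw [hv, Nat.cast_zero, zero_mul]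
          exact U.zero_mem
    | zero => rw [mul_zero]; exact U.zero_mem
    | add r s _ _ hr hs => rw [mul_add]; exact U.add_mem hr hs
    | smul q r _ hr => rw [mul_smul_comm]; exact U.smul_mem q hr
  let φ : ℤ[X] →+* ℝ := (aeval l : ℤ[X] →ₐ[ℤ] ℝ).toRingHom
  have hφU (p : ℤ[X]) {r : ℝ} (hr : r ∈ U) : φ p * r ∈ U := by
    induction p using Polynomial.induction_on' with
    | add p q hp hq => rw [map_add, add_mul]; exact U.add_mem hp hq
    | monomial n c =>
      have h1 : φ (monomial n c) = (c : ℝ) * l ^ n := by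
        simp [φ, aeval_monomial]
      have h2 : l ^ n * r ∈ U := by
        induction n with
        | zero => simpa using hr
        | succ n ih => rw [pow_succ', mul_assoc]; exact hlU (ih (by simp [φ, aeval_monomial]))
      rw [h1, mul_assoc, ← zsmul_eq_mul]
      exact zsmul_mem h2 c
  rcases (h.nonneg w).eq_or_lt with hw | hw
  · rw [← hw]
    exact U.zero_mem
  by_cases hwα : w ∈ α
  · exact hα w hwα
  let β := {v : V // 0 < x v ∧ v ∉ α}
  -- With integer entries the adjugate of the characteristic matrix has entries in `ℤ[X]`, and their
  -- values at `l` act on `U`.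
  let C : Matrix β β ℤ := fun u v => A u v
  let M := C.charmatrix
  let N : Matrix β β ℝ := M.map φ
  have hN (u v : β) : N u v = (if u = v then l else 0) - A u v := by
    simp only [N, M, Matrix.map_apply]
    split_ifs with huv
    · subst huv
      rw [Matrix.charmatrix_apply_eq]
      simp [φ, C]
    · rw [Matrix.charmatrix_apply_ne _ _ _ huv]
      simp [φ, C]
  let y : β → ℝ := fun u => ∑ v, N u v * x v
  have hβ (u : β) : ∑ v : β, (A u v : ℝ) * x v + ∑ v ∈ Finset.univ.filter (fun v => v ∈ α),
      (A u v : ℝ) * x v = l * x u := by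
    have h1 : ∑ v : β, (A u v : ℝ) * x v =
        ∑ v ∈ Finset.univ.filter (fun v => 0 < x v ∧ v ∉ α), (A u v : ℝ) * x v :=
      (Finset.sum_subtype _ (by simp) (fun v => (A u v : ℝ) * x v)).symm
    rw [h1, ← h.eigen, Finset.sum_filter, Finset.sum_filter, ← Finset.sum_add_distrib]
    refine Finset.sum_congr rfl fun v _ => ?_
    by_cases hv : v ∈ α
    · simp [hv]
    · rcases (h.nonneg v).eq_or_lt with hv' | hv'
      · simp [← hv']
      · simp [hv, hv']
  have hy (u : β) : y u = ∑ v ∈ Finset.univ.filter (fun v => v ∈ α), (A u v : ℝ) * x v := by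
    rw [← add_right_inj, hβ u]
    simp only [y, hN, sub_mul, Finset.sum_sub_distrib, ite_mul, zero_mul]
    rw [Finset.sum_eq_single u (fun v _ hv => if_neg hv.symm) (by simp), if_pos rfl]
    ring
  have hyU (u : β) : y u ∈ U := by
    rw [hy]
    exact U.sum_mem fun v hv => hnat _ (hα v (Finset.mem_filter.1 hv).2)
  have hypos (u : β) : 0 < y u := by
    obtain ⟨a, ha⟩ := h.nonempty
    rw [hy]
    refine Finset.sum_pos' (fun v _ => mul_nonneg (Nat.cast_nonneg _) (h.nonneg v))
      ⟨a, by simpa using ha, mul_pos (Nat.cast_pos.2 (Nat.pos_of_ne_zero ?_)) (h.pos_of_mem a ha)⟩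
    exact h.reach u u.2.1 a ha
  -- After scaling column `v` by `x v`, row `u` is diagonally dominant with excess `y u`, which is
  -- positive because `u` leads to `α`.
  have hdet : N.det ≠ 0 := by
    have h1 : (Matrix.of fun u v : β => x v * N u v).det ≠ 0 := by
      refine det_ne_zero_of_sum_row_lt_diag fun u => ?_
      have hu : x u * N u u = y u + ∑ v ∈ Finset.univ.erase u, (A u v : ℝ) * x v := by
        simp only [y]
        rw [← Finset.add_sum_erase _ _ (Finset.mem_univ u), add_assoc, ← Finset.sum_add_distrib,
          Finset.sum_eq_zero, add_zero, mul_comm]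
        intro v hv
        rw [hN, if_neg (Finset.ne_of_mem_erase hv).symm]
        ring
      have hs : ∑ v ∈ Finset.univ.erase u, ‖x v * N u v‖ =
          ∑ v ∈ Finset.univ.erase u, (A u v : ℝ) * x v := by
        refine Finset.sum_congr rfl fun v hv => ?_
        rw [hN, if_neg (Finset.ne_of_mem_erase hv).symm, zero_sub, mul_neg, norm_neg,
          Real.norm_of_nonneg (mul_nonneg v.2.1.le (Nat.cast_nonneg _)), mul_comm]
      simp only [Matrix.of_apply]
      rw [hs]
      refine lt_of_lt_of_le ?_ (le_abs_self _)
      rw [hu]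
      linarith [hypos u]
    rw [Matrix.det_mul_row] at h1
    exact right_ne_zero_of_mul h1
  have hdetφ : φ M.det = N.det := φ.map_det M
  have hcram (u : β) : N.det * x u ∈ U := by
    have h1 : N.adjugate * N = N.det • 1 := N.adjugate_mul
    have h2 : N.det * x u = ∑ v, φ (M.adjugate u v) * y v := by
      have h3 := congrArg (fun T : Matrix β β ℝ => T.mulVec (fun v : β => x v) u) h1
      simp only [← Matrix.mulVec_mulVec, Matrix.smul_mulVec, Matrix.one_mulVec, Pi.smul_apply,
        smul_eq_mul] at h3
      rw [← h3]
      have h4 : N.adjugate = M.adjugate.map φ := (φ.map_adjugate M).symm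
      rw [h4]
      rfl
    rw [h2]
    exact U.sum_mem fun v _ => hφU _ (hyU v)
  -- Multiplication by the determinant is an injective endomorphism of a finite-dimensional rational
  -- space, hence onto.
  have hfin : FiniteDimensional ℚ U := FiniteDimensional.span_of_finite ℚ (Set.toFinite _)
  let T : U →ₗ[ℚ] U := (LinearMap.mulLeft ℚ N.det).restrict fun r hr => by
    change N.det * r ∈ U
    rw [← hdetφ]
    exact hφU _ hr
  have hT : Function.Injective T := fun r s hrs => by
    have : N.det * (r : ℝ) = N.det * s := congrArg Subtype.val hrs
    exact Subtype.ext (mul_left_cancel₀ hdet this)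
  obtain ⟨r, hr⟩ := LinearMap.injective_iff_surjective.1 hT ⟨_, hcram ⟨w, hw, hwα⟩⟩
  have hr' : N.det * (r : ℝ) = N.det * x w := congrArg Subtype.val hr
  rw [← mul_left_cancel₀ hdet hr']
  exact r.2

theorem exists_mul_eq_sum : ∃ m : ℕ, 0 < m ∧ ∀ w, ∃ c : V → ℤ, (∀ v, v ∉ α → c v = 0) ∧
    m * x w = ∑ v, (c v : ℝ) * x v := by
  classical
  choose m c hm hc hmc using fun w => exists_mul_eq_sum_of_mem_span_rat x α (h.mem_span_rat w)
  refine ⟨∏ w, m w, Finset.prod_pos fun w _ => hm w, fun w =>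
    ⟨fun v => (∏ u ∈ Finset.univ.erase w, m u : ℕ) * c w v, fun v hv => by simp [hc w v hv], ?_⟩⟩
  rw [← Finset.mul_prod_erase _ _ (Finset.mem_univ w), Nat.cast_mul, mul_right_comm, hmc,
    Finset.sum_mul]
  refine Finset.sum_congr rfl fun v _ => ?_
  push_cast
  ring

/-- The coefficients outside `α` of an integer combination of the `x w` can be reduced. -/
theorem exists_reduced : ∃ m : ℕ, 0 < m ∧ ∀ (k : V → ℤ) (M : ℤ), ∃ k' : V → ℤ,
    ∑ v, (k' v : ℝ) * x v = ∑ v, (k v : ℝ) * x v ∧ ∀ v, v ∉ α → M ≤ k' v ∧ k' v < M + m := by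
  classical
  obtain ⟨m, hm, hc⟩ := h.exists_mul_eq_sum
  choose c hc hmc using hc
  refine ⟨m, hm, fun k M => ?_⟩
  -- Outside `α`, `Q w` copies of `m * x w` are traded for the equal combination of entries on `α`.
  let Q (w : V) : ℤ := if w ∈ α then 0 else (k w - M) / m
  refine ⟨fun v => k v - m * Q v + ∑ w, Q w * c w v, ?_, fun v hv => ?_⟩
  · have h1 : ∑ v, (∑ w, (Q w : ℝ) * c w v) * x v = ∑ w, (Q w : ℝ) * (m * x w) := by
      simp only [hmc, Finset.mul_sum, Finset.sum_mul]
      rw [Finset.sum_comm]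
      simp only [mul_assoc]
    push_cast
    simp only [add_mul, sub_mul, Finset.sum_add_distrib, Finset.sum_sub_distrib, h1]
    rw [sub_add, sub_eq_self, sub_eq_zero]
    exact Finset.sum_congr rfl fun v _ => by ring
  · have h1 : ∑ w, Q w * c w v = 0 := Finset.sum_eq_zero fun w _ => by rw [hc w v hv, mul_zero]
    have hm' : (0 : ℤ) < m := by exact_mod_cast hm
    have h2 := Int.emod_nonneg (k v - M) hm'.ne'
    have h3 := Int.emod_lt_of_pos (k v - M) hm'
    have h4 := Int.mul_ediv_add_emod (k v - M) m
    simp only [h1, Q, if_neg hv]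
    constructor <;> linarith

/-- A common `N` for all vertices with `l ^ N x w` a combination of the `x v` with large natural
coefficients. -/
theorem exists_large_combination (M : ℕ) : ∃ (N : ℕ) (A' : V → V → ℕ), 0 < N ∧ ∀ w, 0 < x w →
    l ^ N * x w = ∑ v, (A' w v : ℝ) * x v ∧ ∀ v, 0 < x v → M ≤ A' w v := by
  classical
  obtain ⟨m, hm, hred⟩ := h.exists_reduced
  choose k hkx hkM using fun w => hred (Pi.single w 1) M
  have hk (w : V) : ∑ v, (k w v : ℝ) * x v = x w := by
    rw [hkx]
    simp [Pi.single_apply]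
  have hN (p : V × V) : ∃ N, 0 < x p.1 → 0 < x p.2 → ∀ n ≥ N, (M : ℤ) ≤ A.pushRow (k p.1) n p.2 := by
    by_cases hp : 0 < x p.1
    · by_cases hα : p.2 ∈ α
      · obtain ⟨N, hN⟩ := h.exists_le_pushRow_of_mem (k := k p.1) (by rwa [hk]) hα M
        exact ⟨N, fun _ _ => hN⟩
      · exact ⟨0, fun _ hv n _ => h.le_pushRow (Int.natCast_nonneg M)
          (fun w _ hw => (hkM _ w hw).1) n _ hv hα⟩
    · exact ⟨0, fun h => absurd h hp⟩
  choose N hN using hN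
  -- The extra step makes the exponent positive, which later gives `l ^ N > 1`.
  let N' := Finset.univ.sup N + 1
  have hN' (w v) (hw : 0 < x w) (hv : 0 < x v) : (M : ℤ) ≤ A.pushRow (k w) N' v :=
    hN (w, v) hw hv _ ((Finset.le_sup (f := N) (Finset.mem_univ _)).trans (Nat.le_succ _))
  refine ⟨N', fun w v => (A.pushRow (k w) N' v).toNat, Nat.succ_pos _, fun w hw => ⟨?_, ?_⟩⟩
  · rw [← hk w, ← h.sum_pushRow]
    refine Finset.sum_congr rfl fun v _ => ?_
    rcases (h.nonneg v).eq_or_lt with hv | hv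
    · simp [← hv]
    · have := (Int.natCast_nonneg M).trans (hN' w v hw hv)
      congr 1
      exact_mod_cast (Int.toNat_of_nonneg this).symm
  · intro v hv
    exact Int.le_toNat ((Int.natCast_nonneg M).trans (hN' w v hw hv)) |>.2 (hN' w v hw hv)

/-- The possible values of a measure with the values `x w / l ^ n` at the cylinders of level `n`. -/
theorem values_eq (hh : ℕ → V → ℕ) (hsucc : ∀ n v, hh (n + 1) v = ∑ w, hh n w * A w v)
    (hone : ∑ w, (hh 0 w : ℝ) * x w = 1) (htop : ∀ c, ∃ N, ∀ n ≥ N, ∀ w, c ≤ hh n w) :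
    {a : ℝ | ∃ (j : ℕ) (k : V → ℕ), (∀ w, k w ≤ hh j w) ∧ ∑ w, (k w : ℝ) * (x w / l ^ j) = a} =
      {a : ℝ | 0 ≤ a ∧ a ≤ 1 ∧ ∃ (n : ℕ) (k : V → ℤ), l ^ n * a = ∑ w, (k w : ℝ) * x w} := by
  classical
  have hpush (n N : ℕ) : ∀ v, A.pushRow (fun w => (hh n w : ℤ)) N v = hh (n + N) v := by
    induction N with
    | zero => exact fun _ => rfl
    | succ N ih =>
      intro v
      rw [← add_assoc, hsucc]
      simp only [Matrix.pushRow, ih]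
      push_cast
      rfl
  have hsum (n : ℕ) : ∑ w, (hh n w : ℝ) * x w = l ^ n := by
    have := h.sum_pushRow (fun w => (hh 0 w : ℤ)) n
    simp only [hpush, zero_add, Int.cast_natCast, hone, mul_one] at this
    exact this
  have hl := h.pos
  have hdiv (j : ℕ) (k : V → ℝ) : ∑ w, k w * (x w / l ^ j) = (∑ w, k w * x w) / l ^ j := by
    rw [Finset.sum_div]
    exact Finset.sum_congr rfl fun w _ => by rw [mul_div_assoc]
  ext a
  constructor
  · rintro ⟨j, k, hk, rfl⟩
    refine ⟨Finset.sum_nonneg fun w _ => mul_nonneg (Nat.cast_nonneg _)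
      (div_nonneg (h.nonneg w) (by positivity)), ?_, j, fun w => k w, ?_⟩
    · rw [hdiv, div_le_one (by positivity), ← hsum j]
      exact Finset.sum_le_sum fun w _ =>
        mul_le_mul_of_nonneg_right (Nat.cast_le.2 (hk w)) (h.nonneg w)
    · rw [hdiv, mul_div_cancel₀ _ (by positivity)]
      simp
  · rintro ⟨ha0, ha1, n, k, hk⟩
    rcases ha0.eq_or_lt with rfl | ha0
    · exact ⟨0, 0, fun _ => Nat.zero_le _, by simp⟩
    rcases ha1.eq_or_lt with rfl | ha1
    · exact ⟨0, hh 0, fun _ => le_rfl, by rw [hdiv, hsum, div_self (by positivity)]⟩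
    -- Waiting until all path counts are at least `m` lets the reduced coefficients in `[0, m)` fit
    -- below them outside `α`. Both `k'` and its complement `d` are then non-negative there and have
    -- positive value, so further multiplication by `A` makes both non-negative on `α` too.
    obtain ⟨m, hm, hred⟩ := h.exists_reduced
    obtain ⟨N₀, hN₀⟩ := htop m
    let n' := n + N₀
    obtain ⟨k', hk', hk'm⟩ := hred (A.pushRow k N₀) 0
    have hk'a : ∑ v, (k' v : ℝ) * x v = l ^ n' * a := by
      rw [hk', h.sum_pushRow, ← hk]
      simp only [n']
      ring
    let d : V → ℤ := fun v => hh n' v - k' v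
    have hda : ∑ v, (d v : ℝ) * x v = l ^ n' * (1 - a) := by
      simp only [d, Int.cast_sub, Int.cast_natCast, sub_mul, Finset.sum_sub_distrib, hk'a, hsum]
      ring
    have hdβ (v : V) (hv : v ∉ α) : 0 ≤ d v := by
      have h1 := hN₀ n' (Nat.le_add_left _ _) v
      have h2 := (hk'm v hv).2
      simp only [d]
      omega
    have hN (v : V) : ∃ N, 0 < x v → ∀ n ≥ N, 0 ≤ A.pushRow k' n v ∧ 0 ≤ A.pushRow d n v := by
      by_cases hv : v ∈ α
      · obtain ⟨N, hN⟩ := h.exists_le_pushRow_of_mem (k := k')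
          (by rw [hk'a]; positivity) hv 0
        obtain ⟨N', hN'⟩ := h.exists_le_pushRow_of_mem (k := d)
          (by rw [hda]; exact mul_pos (by positivity) (sub_pos.2 ha1)) hv 0
        exact ⟨max N N', fun _ n hn => ⟨hN n (le_of_max_le_left hn), hN' n (le_of_max_le_right hn)⟩⟩
      · exact ⟨0, fun hx n _ => ⟨h.le_pushRow le_rfl (fun w _ hw => (hk'm w hw).1) n v hx hv,
          h.le_pushRow le_rfl (fun w _ hw => hdβ w hw) n v hx hv⟩⟩
    choose N hN using hN
    let N' := Finset.univ.sup N
    have hN' (v) (hv : 0 < x v) := hN v hv N' (Finset.le_sup (f := N) (Finset.mem_univ v))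
    have hd' : ∀ (j : ℕ) v, A.pushRow d j v = hh (n' + j) v - A.pushRow k' j v := by
      intro j
      induction j with
      | zero => exact fun _ => rfl
      | succ j ih =>
        intro v
        simp only [Matrix.pushRow, ih, sub_mul, Finset.sum_sub_distrib, ← add_assoc, hsucc]
        push_cast
        rfl
    -- Where `x` vanishes the entries are uncontrolled but contribute nothing, so they are set to 0.
    refine ⟨n' + N', fun v => if 0 < x v then (A.pushRow k' N' v).toNat else 0, fun v => ?_, ?_⟩
    · dsimp only
      split_ifs with hv
      · have h1 := hN' v hv
        rw [hd'] at h1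
        omega
      · exact Nat.zero_le _
    · rw [hdiv, div_eq_iff (by positivity), pow_add, mul_comm a, mul_comm (l ^ n'), mul_assoc,
        ← hk'a, ← h.sum_pushRow]
      refine Finset.sum_congr rfl fun v _ => ?_
      rcases (h.nonneg v).eq_or_lt with hv | hv
      · simp [← hv]
      · simp only [if_pos hv]
        congr 1
        exact_mod_cast Int.toNat_of_nonneg (hN' v hv).1

end IsDistinguished

/-! ### Zero patterns of matrix powers -/

theorem Matrix.mul_apply_ne_zero_iff {V : Type*} [Fintype V] (X Y : Matrix V V ℕ) (w v : V) :
    (X * Y) w v ≠ 0 ↔ ∃ u, X w u ≠ 0 ∧ Y u v ≠ 0 := by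
  simp [Matrix.mul_apply, Finset.sum_eq_zero_iff]

/-- Some power of a non-negative matrix has an idempotent zero pattern. -/
theorem Matrix.exists_pow_pattern_idempotent {V : Type*} [Fintype V] [DecidableEq V]
    (A : Matrix V V ℕ) :
    ∃ p > 0, ∀ w v, (A ^ p * A ^ p) w v ≠ 0 ↔ (A ^ p) w v ≠ 0 := by
  let pat (n : ℕ) : Set (V × V) := {q | (A ^ n) q.1 q.2 ≠ 0}
  have hadd {m n : ℕ} (hmn : pat m = pat n) (k : ℕ) : pat (m + k) = pat (n + k) := by
    ext ⟨w, v⟩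
    have h (u : V) : (A ^ m) w u ≠ 0 ↔ (A ^ n) w u ≠ 0 := Set.ext_iff.1 hmn (w, u)
    change (A ^ (m + k)) w v ≠ 0 ↔ (A ^ (n + k)) w v ≠ 0
    rw [pow_add, pow_add, Matrix.mul_apply_ne_zero_iff, Matrix.mul_apply_ne_zero_iff]
    simp only [h]
  obtain ⟨i, d, hd, hid⟩ : ∃ i d, 0 < d ∧ pat i = pat (i + d) := by
    obtain ⟨i, j, hij, h⟩ := Finite.exists_ne_map_eq_of_infinite pat
    rcases lt_or_gt_of_ne hij with hlt | hlt
    · exact ⟨i, j - i, by omega, by rw [h, Nat.add_sub_cancel' hlt.le]⟩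
    · exact ⟨j, i - j, by omega, by rw [← h, Nat.add_sub_cancel' hlt.le]⟩
  have hper (n : ℕ) (hn : i ≤ n) (k : ℕ) : pat n = pat (n + k * d) := by
    induction k with
    | zero => simp
    | succ k ih =>
      obtain ⟨e, rfl⟩ := Nat.exists_eq_add_of_le hn
      have h := hadd hid (e + k * d)
      rw [ih, add_assoc i e, h]
      congr 1
      ring
  -- There are finitely many patterns, so from `i` on they have period `d`; this exponent is at
  -- least `i` and divisible by `d`, hence doubling it keeps the pattern.
  refine ⟨(i + 1) * d, by positivity, fun w v => ?_⟩
  have h := hper ((i + 1) * d) ((Nat.le_succ i).trans (Nat.le_mul_of_pos_right _ hd)) (i + 1)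
  rw [← pow_add]
  exact (Set.ext_iff.1 h (w, v)).symm

/-! ### From an ergodic measure to a distinguished eigenvector -/

namespace StationaryBratteliDiagram

variable {B : StationaryBratteliDiagram}

open Filter Topology Matrix

theorem pathCount_vertex_le_succ (x : B.PathSpace) (n : ℕ) :
    B.pathCount n (x.vertex n) ≤ B.pathCount (n + 1) (x.vertex (n + 1)) := by
  have h : B.incidence (x.vertex n) (x.vertex (n + 1)) ≠ 0 :=
    exists_edge_iff.2 ⟨x.edge n, rfl, x.rng_edge n⟩
  rw [← levelCount_univ (n + 1), levelCount_succ (isLevel_univ n), levelCount_univ]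
  exact (Nat.le_mul_of_pos_right _ (Nat.pos_of_ne_zero h)).trans
    (Finset.single_le_sum
      (f := fun w => B.pathCount n w * B.incidence w (x.vertex (n + 1)))
      (fun _ _ => Nat.zero_le _) (Finset.mem_univ _))

theorem isLevel_vertex_preimage (n : ℕ) (s : Set B.V) :
    IsLevel n {x : B.PathSpace | x.vertex n ∈ s} := fun x hx y hy => by
  change y.vertex n ∈ s
  rw [vertex_eq_of_mem hy le_rfl]
  exact hx

/-- If small counts recur at arbitrarily high levels, compactness gives a path `x` all of whose
vertices have fewer than `c` incoming finite paths, because counts do not decrease along a path. But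
`c` paths tail equivalent to `x` all agree with it from some level on, and have distinct initial
segments ending at the same vertex of `x`. -/
theorem exists_le_pathCount (hB : B.IsAperiodic) (c : ℕ) :
    ∃ N, ∀ n ≥ N, ∀ w, c ≤ B.pathCount n w := by
  by_contra! hcon
  let K (n : ℕ) : Set B.PathSpace := {x | x.vertex n ∈ {w | B.pathCount n w < c}}
  have hK (n : ℕ) : IsClosed (K n) := (isLevel_vertex_preimage n _).isClopen.isClosed
  have hanti : Antitone K := antitone_nat_of_succ_le fun n x hx =>
    (pathCount_vertex_le_succ x n).trans_lt hx
  have hne (n : ℕ) : (K n).Nonempty := by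
    obtain ⟨m, hm, w, hw⟩ := hcon n
    obtain ⟨x, rfl⟩ := exists_vertex_eq m w
    exact ⟨x, hanti hm hw⟩
  obtain ⟨x, hx⟩ := IsCompact.nonempty_iInter_of_directed_nonempty_isCompact_isClosed K
    hanti.directed_ge hne (fun n => (hK n).isCompact) hK
  obtain ⟨T, hT, hTc⟩ := (hB x).exists_subset_card_eq c
  have hT' : ∀ y : B.PathSpace, ∃ N, y ∈ T → ∀ i ≥ N, x.edge i = y.edge i := fun y => by
    by_cases hy : y ∈ T
    · obtain ⟨N, hN⟩ := hT hy
      exact ⟨N, fun _ => hN⟩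
    · exact ⟨0, fun h => absurd h hy⟩
  choose N hN using hT'
  let M := T.sup N
  have hM (y) (hy : y ∈ T) (i) (hi : M ≤ i) : x.edge i = y.edge i :=
    hN y hy i ((Finset.le_sup hy).trans hi)
  have hlt : B.pathCount M (x.vertex M) < c := Set.mem_iInter.1 hx M
  refine hlt.not_ge ?_
  rw [← hTc]
  refine Finset.card_le_card_of_injOn (fun y => y.toPrefix M) (fun y hy => ?_) ?_
  · simp only [Finset.coe_filter, Finset.mem_univ, true_and, Set.mem_ofPred_eq, endpoint_toPrefix]
    exact congrArg B.src (hM y hy M le_rfl).symm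
  · intro y hy z hz hyz
    have h := toPrefix_eq_iff.1 hyz
    refine PathSpace.ext_edges h.1 fun i => ?_
    rcases lt_or_ge i M with hi | hi
    · exact h.2 i hi
    · rw [← hM y hy i hi, ← hM z hz i hi]

theorem incidence_pow_vertex_ne_zero (x : B.PathSpace) (n m : ℕ) :
    (B.incidence ^ m) (x.vertex n) (x.vertex (n + m)) ≠ 0 := by
  induction m with
  | zero => simp
  | succ m ih =>
    rw [pow_succ, Matrix.mul_apply_ne_zero_iff]
    exact ⟨_, ih, exists_edge_iff.2 ⟨x.edge (n + m), rfl, x.rng_edge (n + m)⟩⟩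

/-- An ergodic invariant measure is given by an eigenvector of a power of the incidence matrix. -/
theorem exists_isDistinguished {μ : Measure B.PathSpace} (hμ : B.MemS μ) :
    ∃ (p : ℕ) (x : B.V → ℝ) (l : ℝ) (α : Set B.V), 0 < p ∧
      IsDistinguished (B.incidence ^ p) x l α ∧
      ∀ j w, weight μ Set.univ (p * j) w = x w / l ^ j := by
  classical
  have := hμ.isProbability
  obtain ⟨p, hp, hidem⟩ := B.incidence.exists_pow_pattern_idempotent
  let A := B.incidence ^ p
  have htrans {w u v : B.V} (h1 : A w u ≠ 0) (h2 : A u v ≠ 0) : A w v ≠ 0 :=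
    (hidem w v).1 ((Matrix.mul_apply_ne_zero_iff _ _ _ _).2 ⟨u, h1, h2⟩)
  have hpow (n : ℕ) {w v : B.V} (h : (A ^ (n + 1)) w v ≠ 0) : A w v ≠ 0 := by
    induction n generalizing v with
    | zero => simpa using h
    | succ n ih =>
      rw [pow_succ, Matrix.mul_apply_ne_zero_iff] at h
      obtain ⟨u, h1, h2⟩ := h
      exact htrans (ih h1) h2
  let cls (a : B.V) : Set B.V := {v | A a v ≠ 0 ∧ A v a ≠ 0}
  let E (a : B.V) (J : ℕ) : Set B.PathSpace := {x | ∀ j ≥ J, x.vertex (p * j) ∈ cls a}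
  have hEtail (a J) : IsTailSet (p * J) (E a J) := fun x y hxy hx j hj => by
    have : y.vertex (p * j) = x.vertex (p * j) :=
      congrArg B.src (hxy (p * j) (Nat.mul_le_mul_left p hj)).symm
    rw [this]
    exact hx j hj
  have hEmeas (a J) : MeasurableSet (E a J) := by
    have : E a J = ⋂ j ≥ J, {x : B.PathSpace | x.vertex (p * j) ∈ cls a} := by
      ext x
      simp [E]
    rw [this]
    exact MeasurableSet.iInter fun j => MeasurableSet.iInter fun _ =>
      (isLevel_vertex_preimage _ _).isOpen.measurableSet
  have hEmono (a) : Monotone (E a) := fun J J' hJ x hx j hj => hx j (hJ.trans hj)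
  -- Some vertex occurs at infinitely many telescoped levels. Every vertex at a telescoped level
  -- after its first such visit is reached from it and leads back to it.
  have hcover : (⋃ a, ⋃ J, E a J) = Set.univ := by
    refine Set.eq_univ_of_forall fun x => ?_
    have hrel (j k : ℕ) : A (x.vertex (p * j)) (x.vertex (p * (j + (k + 1)))) ≠ 0 := by
      refine hpow k ?_
      rw [← pow_mul, Nat.mul_add p j]
      exact incidence_pow_vertex_ne_zero x _ _
    have hrel' {j j' : ℕ} (hj : j < j') : A (x.vertex (p * j)) (x.vertex (p * j')) ≠ 0 := by
      obtain ⟨k, rfl⟩ := Nat.exists_eq_add_of_lt hj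
      exact hrel j k
    obtain ⟨a, ha⟩ := Finite.exists_infinite_fiber fun j => x.vertex (p * j)
    rw [Set.infinite_coe_iff] at ha
    obtain ⟨J, hJ⟩ := ha.nonempty
    obtain rfl : x.vertex (p * J) = a := hJ
    refine Set.mem_iUnion₂.2 ⟨_, J + 1, fun j hj => ⟨hrel' hj, ?_⟩⟩
    obtain ⟨j', hj', hlt⟩ := ha.exists_gt j
    have h := hrel' hlt
    rwa [show x.vertex (p * j') = x.vertex (p * J) from hj'] at h
  -- The sets are invariant and finitely many cover everything, so they cannot all be null.
  obtain ⟨a, ha⟩ : ∃ a, μ (⋃ J, E a J)ᶜ = 0 := by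
    have hinv (a) : μ (⋃ J, E a J) = 0 ∨ μ (⋃ J, E a J)ᶜ = 0 := by
      refine hμ.ergodic _ (MeasurableSet.iUnion (hEmeas a)) fun x y hxy hx => ?_
      obtain ⟨N, hN⟩ := hxy
      obtain ⟨J, hJ⟩ := Set.mem_iUnion.1 hx
      refine Set.mem_iUnion.2 ⟨max J N, fun j hj => ?_⟩
      have h1 : N ≤ p * j := (le_of_max_le_right hj).trans (Nat.le_mul_of_pos_left j hp)
      have : y.vertex (p * j) = x.vertex (p * j) := congrArg B.src (hN _ h1).symm
      rw [this]
      exact hJ j (le_of_max_le_left hj)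
    by_contra! hne
    have h0 : μ (⋃ a, ⋃ J, E a J) = 0 :=
      measure_iUnion_null fun a => (hinv a).resolve_right (hne a)
    rw [hcover, measure_univ] at h0
    exact one_ne_zero h0
  let α := cls a
  have hlim (n w) : Tendsto (fun J => weight μ (E a J) n w) atTop (𝓝 (weight μ Set.univ n w)) := by
    have h1 := tendsto_measure_iUnion_atTop (μ := μ)
      (s := fun J => cylinder (exists_vertex_eq n w).choose n ∩ E a J)
      (fun J J' hJ => Set.inter_subset_inter_right _ (hEmono a hJ))
    rw [← Set.inter_iUnion, measure_inter_conull ha] at h1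
    rw [weight, Set.inter_univ]
    exact (ENNReal.tendsto_toReal (measure_ne_top μ _)).comp h1
  have hle (J n w) : weight μ (E a J) n w ≤ weight μ Set.univ n w :=
    measureReal_mono (Set.inter_subset_inter_right _ (Set.subset_univ _))
  -- The weight of the paths staying in `α` from telescoped level `J` on: it vanishes off `α` and
  -- obeys the recursion of the positive block.
  let z (J : ℕ) (w : B.V) : ℝ := weight μ (E a J) (p * J) w
  have hz0 (J w) : 0 ≤ z J w := weight_nonneg _ _ _ _
  have hzα (J w) (hw : w ∉ α) : z J w = 0 := by
    have : cylinder (exists_vertex_eq (p * J) w).choose (p * J) ∩ E a J = ∅ := by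
      refine Set.eq_empty_of_forall_notMem fun x hx => hw ?_
      rw [← (exists_vertex_eq (p * J) w).choose_spec, ← vertex_eq_of_mem hx.1 le_rfl]
      exact hx.2 J le_rfl
    simp [z, weight, this]
  have hzpow (j i : ℕ) (w) : weight μ (E a (j + i)) (p * j) w =
      ∑ v, ((A ^ i) w v : ℝ) * z (j + i) v := by
    have h := weight_add hμ.invariant (hEmeas a (j + i)) (n := p * j) (m := p * i)
      (by rw [← Nat.mul_add]; exact hEtail a (j + i))
    rw [h, ← Nat.mul_add, pow_mul]
    rfl
  have hzsucc (J w) (hw : w ∈ α) : z J w = ∑ v, (A w v : ℝ) * z (J + 1) v := by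
    have h1 := hzpow J 1 w
    rw [pow_one] at h1
    rw [← h1]
    have : cylinder (exists_vertex_eq (p * J) w).choose (p * J) ∩ E a J =
        cylinder (exists_vertex_eq (p * J) w).choose (p * J) ∩ E a (J + 1) := by
      ext x
      refine and_congr_right fun hx => ⟨fun h => hEmono a J.le_succ h, fun h j hj => ?_⟩
      rcases hj.eq_or_lt with rfl | hj
      · rw [vertex_eq_of_mem hx le_rfl, (exists_vertex_eq (p * J) w).choose_spec]
        exact hw
      · exact h j hj
    simp only [z, weight, this]
  have hzsucc' (J) (w : α) : z J w = ∑ v : α, (A w v : ℝ) * z (J + 1) v := by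
    rw [hzsucc J w w.2, ← Finset.sum_subtype (Finset.univ.filter fun v => v ∈ α) (by simp)
      (fun v => (A w v : ℝ) * z (J + 1) v), Finset.sum_filter]
    refine Finset.sum_congr rfl fun v _ => ?_
    split_ifs with hv
    · rfl
    · rw [hzα _ v hv, mul_zero]
  have hAα (w v : α) : (0 : ℝ) < A w v :=
    Nat.cast_pos.2 (Nat.pos_of_ne_zero (htrans w.2.2 v.2.1))
  have htotal (n : ℕ) : ∑ w, (B.pathCount n w : ℝ) * weight μ Set.univ n w = 1 := by
    rw [← levelCount_univ, ← real_inter_of_isLevel hμ.invariant .univ (isTailSet_univ n)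
      (isLevel_univ n)]
    simp
  -- By positivity of the block, one zero would spread to all later levels; taking limits, all
  -- weights at level 0 would vanish.
  have hzpos (J) (w : α) : 0 < z J w := by
    by_contra hcon
    have hzero : ∀ i, ∀ v : α, z (J + 1 + i) v = 0 := by
      have hstep (J) (w : α) (hw : z J w = 0) (v : α) : z (J + 1) v = 0 := by
        rw [hzsucc', Finset.sum_eq_zero_iff_of_nonneg
          fun v _ => mul_nonneg (Nat.cast_nonneg _) (hz0 _ _)] at hw
        exact (mul_eq_zero.1 (hw v (Finset.mem_univ v))).resolve_left (hAα w v).ne'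
      intro i
      induction i with
      | zero => exact hstep J w (le_antisymm (not_lt.1 hcon) (hz0 _ _))
      | succ i ih => exact hstep (J + 1 + i) w (ih w)
    have h0 (w) : weight μ Set.univ 0 w = 0 := by
      refine tendsto_nhds_unique (hlim 0 w) (tendsto_const_nhds.congr' ?_)
      filter_upwards [eventually_ge_atTop (J + 1)] with K hK
      obtain ⟨i, rfl⟩ := Nat.exists_eq_add_of_le hK
      have h := hzpow 0 (J + 1 + i) w
      rw [mul_zero, zero_add] at h
      rw [h]
      refine (Finset.sum_eq_zero fun v _ => ?_).symm
      by_cases hv : v ∈ α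
      · rw [hzero i ⟨v, hv⟩, mul_zero]
      · rw [hzα _ v hv, mul_zero]
    have := htotal 0
    simp [h0] at this
  -- The shifted sequence satisfies the same recursion, hence is a multiple of the original; `c⁻¹`
  -- is the eigenvalue.
  obtain ⟨c, hc0, hc⟩ := exists_eq_mul_of_pos (C := fun w v : α => (A w v : ℝ)) hAα
    (u := fun J w => z (J + 1) w) (v := fun J w => z J w) (fun _ _ => hz0 _ _) hzpos
    (fun J w => hzsucc' (J + 1) w) (fun J w => hzsucc' J w)
  have hαne : α.Nonempty := by
    by_contra hne
    have : (⋃ J, E a J) = ∅ := by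
      refine Set.eq_empty_of_forall_notMem fun x hx => ?_
      obtain ⟨J, hJ⟩ := Set.mem_iUnion.1 hx
      exact hne ⟨_, hJ J le_rfl⟩
    rw [this, Set.compl_empty, measure_univ] at ha
    exact one_ne_zero ha
  obtain ⟨b, hb⟩ := hαne
  have hcpos : 0 < c := by
    refine hc0.lt_of_ne fun h => (hzpos 1 ⟨b, hb⟩).ne' ?_
    rw [hc 0 ⟨b, hb⟩, ← h, zero_mul]
  have hczn (J w) : z (J + 1) w = c * z J w := by
    by_cases hw : w ∈ α
    · exact hc J ⟨w, hw⟩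
    · rw [hzα _ w hw, hzα _ w hw, mul_zero]
  -- The full weights are limits of the weights of `E a J`, which are linear in `z`, so they scale
  -- in the same way.
  have hX (j w) : weight μ Set.univ (p * (j + 1)) w = c * weight μ Set.univ (p * j) w := by
    have h1 := ((hlim (p * (j + 1)) w).comp (tendsto_add_atTop_nat (j + 1)))
    have h2 := ((hlim (p * j) w).comp (tendsto_add_atTop_nat j)).const_mul c
    refine tendsto_nhds_unique h1 (h2.congr fun i => ?_)
    simp only [Function.comp]
    rw [add_comm i j, add_comm i (j + 1), hzpow, hzpow, Finset.mul_sum]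
    refine Finset.sum_congr rfl fun v _ => ?_
    rw [add_right_comm, hczn]
    ring
  let x (w : B.V) : ℝ := weight μ Set.univ 0 w
  have hXj (j w) : weight μ Set.univ (p * j) w = x w / (c⁻¹) ^ j := by
    rw [inv_pow, div_inv_eq_mul]
    induction j with
    | zero => simp [x]
    | succ j ih => rw [hX, ih]; ring
  have hx0 (w) : 0 ≤ x w := weight_nonneg _ _ _ _
  have heigen (w) : ∑ v, (A w v : ℝ) * x v = c⁻¹ * x w := by
    have h := weight_add hμ.invariant .univ (n := 0) (m := p) (isTailSet_univ _)
    have h' : x w = ∑ v, (A w v : ℝ) * weight μ Set.univ (p * 1) v := by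
      rw [mul_one, ← zero_add p]
      exact congrFun h w
    rw [h', Finset.mul_sum]
    refine Finset.sum_congr rfl fun v _ => ?_
    rw [hXj, pow_one]
    field_simp
  have hreach (w) (hw : 0 < x w) (b) (hb : b ∈ α) : A w b ≠ 0 := by
    obtain ⟨J, hJ⟩ := ((hlim 0 w).eventually (lt_mem_nhds hw)).exists
    have h := hzpow 0 J w
    rw [mul_zero, zero_add] at h
    rw [h] at hJ
    obtain ⟨v, -, hv⟩ := Finset.exists_ne_zero_of_sum_ne_zero hJ.ne'
    have hvα : v ∈ α := by
      by_contra hvα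
      exact hv (by rw [hzα _ v hvα, mul_zero])
    have hAJ : (A ^ J) w v ≠ 0 := fun h0 => hv (by rw [h0, Nat.cast_zero, zero_mul])
    have hvb : A v b ≠ 0 := htrans hvα.2 hb.1
    cases J with
    | zero =>
      obtain rfl : w = v := by
        by_contra hwv
        simp [Matrix.one_apply_ne hwv] at hAJ
      exact hvb
    | succ J => exact htrans (hpow J hAJ) hvb
  refine ⟨p, x, c⁻¹, α, hp, ⟨?_, hx0, heigen, ⟨b, hb⟩, fun v hv => ?_, hreach, ?_, fun v => ?_⟩, hXj⟩
  -- If `l ≤ 1`, cylinders ending at `b` at levels `p * N` have mass at least `x b > 0`, while the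
  -- number of such cylinders tends to infinity.
  · by_contra hcon
    have hc1 : c⁻¹ ≤ 1 := not_lt.1 hcon
    have hxb : 0 < x b := (hzpos 0 ⟨b, hb⟩).trans_le (hle 0 (p * 0) b)
    obtain ⟨M, hM⟩ := exists_nat_gt (1 / x b)
    obtain ⟨N, hN⟩ := exists_le_pathCount hμ.memD.aperiodic M
    have h1 := htotal (p * N)
    have h2 : (M : ℝ) * x b ≤ B.pathCount (p * N) b * weight μ Set.univ (p * N) b := by
      have h3 : (M : ℝ) ≤ B.pathCount (p * N) b :=
        Nat.cast_le.2 (hN _ (Nat.le_mul_of_pos_left N hp) b)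
      have h4 : x b ≤ weight μ Set.univ (p * N) b := by
        rw [hXj]
        exact le_div_self hxb.le (by positivity) (pow_le_one₀ (by positivity) hc1)
      exact mul_le_mul h3 h4 hxb.le (Nat.cast_nonneg _)
    have h5 := Finset.single_le_sum
      (f := fun w => (B.pathCount (p * N) w : ℝ) * weight μ Set.univ (p * N) w)
      (fun w _ => mul_nonneg (Nat.cast_nonneg _) (weight_nonneg _ _ _ _)) (Finset.mem_univ b)
    rw [div_lt_iff₀ hxb] at hM
    linarith
  · exact (hzpos 0 ⟨v, hv⟩).trans_le (hle 0 (p * 0) v)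
  · intro b hb v hbv hv
    exact ⟨htrans hb.1 hbv, htrans (hreach v hv b hb) hb.2⟩
  · obtain ⟨y, rfl⟩ := exists_vertex_eq (0 + p) v
    exact ⟨_, incidence_pow_vertex_ne_zero y 0 p⟩

end StationaryBratteliDiagram

/-! ### Good measures on diagrams with positive incidence matrix -/

namespace StationaryBratteliDiagram

variable {B : StationaryBratteliDiagram}

open Filter Topology

theorem sum_pathCount_zero (g : B.V → ℝ) :
    ∑ w, (B.pathCount 0 w : ℝ) * g w = ∑ e, g (B.rng₀ e) := by
  rw [← Finset.sum_fiberwise _ (fun e => B.rng₀ e)]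
  refine Finset.sum_congr rfl fun w _ => ?_
  rw [pathCount_zero, Finset.sum_congr rfl (g := fun _ => g w), Finset.sum_const, nsmul_eq_mul]
  intro e he
  rw [(Finset.mem_filter.1 he).2]

section Positive

variable (hB : ∀ w v, 2 ≤ B.incidence w v)

include hB

theorem perfectSpace_of_two_le_incidence : PerfectSpace B.PathSpace := by
  rw [perfectSpace_iff_forall_not_isolated]
  intro x
  rw [← mem_closure_iff_nhdsWithin_neBot, isTopologicalBasis_cylinder.mem_closure_iff]
  rintro _ ⟨z, n, rfl⟩ hxz
  rw [← cylinder_eq_of_mem hxz]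
  obtain ⟨e, he, hne⟩ := Finset.exists_mem_ne
    (one_lt_two.trans_le (hB (x.vertex n) (x.vertex (n + 1)))) (x.edge n)
  simp only [Finset.mem_filter] at he
  refine ⟨extend x n e he.2.1, extend_mem_cylinder _ _ _ _, fun h => hne ?_⟩
  rw [← extend_edge x n e he.2.1, Set.mem_singleton_iff.1 h]

theorem isSimple_of_two_le_incidence : B.IsSimple := by
  intro x
  rw [isTopologicalBasis_cylinder.dense_iff]
  rintro _ ⟨c, n, rfl⟩ -
  obtain ⟨e, he, he'⟩ := exists_edge_iff.1
    (two_pos.trans_le (hB (c.vertex n) (x.vertex (n + 1)))).ne'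
  have h : B.src (x.edge (n + 1 + 0)) = (extend c n e he).vertex (n + 1) := by
    rw [extend_vertex, he']
    rfl
  refine ⟨splice (extend c n e he) (n + 1) (fun i => x.edge (n + 1 + i)) h
    (fun i => x.rng_edge (n + 1 + i)), ?_, n + 1, fun i hi => ?_⟩
  · exact mem_cylinder_trans (extend_mem_cylinder c n e he)
      (cylinder_anti _ n.le_succ (splice_mem_cylinder _ _ _ _ _))
  · exact ((splice_edge_ge _ _ _ _ hi).trans (by simp only [Nat.add_sub_cancel' hi])).symm

/-- A finite tail class would be closed and dense, hence the whole space, which is infinite because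
it is perfect. -/
theorem memD_of_two_le_incidence : B.MemD := by
  have hp := perfectSpace_of_two_le_incidence hB
  refine ⟨⟨inferInstance, inferInstance, inferInstance, inferInstance, hp⟩, fun x hfin => ?_⟩
  have huniv : {y | TailEquiv x y} = Set.univ := by
    rw [← hfin.isClosed.closure_eq]
    exact (isSimple_of_two_le_incidence hB x).closure_eq
  rw [huniv] at hfin
  have := perfectSpace_iff_forall_not_isolated.1 hp x
  exact infinite_of_mem_nhds x Filter.univ_mem hfin

/-- A positive eigenvector of a positive incidence matrix gives a good ergodic measure. -/
theorem exists_good_measure (hrng : Function.Bijective B.rng₀) {p : B.V → ℝ} (hp : ∀ w, 0 < p w)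
    (hp1 : ∑ w, p w = 1) {l : ℝ} (hl : 1 < l)
    (heigen : ∀ w, ∑ v, (B.incidence w v : ℝ) * p v = l * p w) :
    ∃ ν : Measure B.PathSpace, B.MemS ν ∧ IsGoodMeasure ν ∧
      clopenValues ν = {a : ℝ | 0 ≤ a ∧ a ≤ 1 ∧
        ∃ (n : ℕ) (k : B.V → ℤ), l ^ n * a = ∑ w, (k w : ℝ) * p w} := by
  have hl0 : 0 < l := one_pos.trans hl
  have hpos (w v) : B.incidence w v ≠ 0 := (two_pos.trans_le (hB w v)).ne'
  have hD : IsDistinguished B.incidence p l Set.univ :=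
    ⟨hl, fun w => (hp w).le, heigen, Set.univ_nonempty, fun w _ => hp w, fun w _ v _ => hpos w v,
      fun _ _ _ _ _ => Set.mem_univ _, fun v => ⟨v, hpos v v⟩⟩
  have hz0 (n : ℕ) (w : B.V) : 0 < p w / l ^ n := div_pos (hp w) (pow_pos hl0 n)
  have hz (n : ℕ) (w : B.V) :
      p w / l ^ n = ∑ v, (B.incidence w v : ℝ) * (p v / l ^ (n + 1)) := by
    have h : ∑ v, (B.incidence w v : ℝ) * (p v / l ^ (n + 1)) = (l * p w) / l ^ (n + 1) := by
      rw [← heigen, Finset.sum_div]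
      exact Finset.sum_congr rfl fun v _ => by rw [mul_div_assoc]
    rw [h]
    field_simp
    ring
  have hone : ∑ w, (B.pathCount 0 w : ℝ) * p w = 1 := by
    rw [sum_pathCount_zero, hrng.sum_comp p, hp1]
  obtain ⟨ν, hν, hcyl⟩ := exists_measure_real_cylinder_eq (fun n w => p w / l ^ n)
    (fun n w => (hz0 n w).le) hz (by simpa using hone)
  have hinv : IsTailInvariant ν := fun n x y hxy => by rw [hcyl, hcyl, hxy]
  have hweight (n w) : weight ν Set.univ n w = p w / l ^ n := by
    obtain ⟨x, rfl⟩ := exists_vertex_eq n w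
    rw [← real_cylinder_inter hinv .univ (isTailSet_univ n), Set.inter_univ, Measure.real, hcyl,
      ENNReal.toReal_ofReal (hz0 _ _).le]
  have hMD := memD_of_two_le_incidence hB
  have hpush {n : ℕ} {U : Set B.PathSpace} (hU : IsLevel n U) (N : ℕ) :
      ∀ v, B.incidence.pushRow (fun w => (levelCount n U w : ℤ)) N v = levelCount (n + N) U v := by
    induction N with
    | zero => exact fun _ => rfl
    | succ N ih =>
      intro v
      rw [← add_assoc, levelCount_succ (hU.mono (n.le_add_right N))]
      simp only [Matrix.pushRow, ih, Matrix.vecMul, dotProduct]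
      push_cast
      rfl
  have hreal {n : ℕ} {U : Set B.PathSpace} (hU : IsLevel n U) :
      ν.real U = (∑ w, (levelCount n U w : ℝ) * p w) / l ^ n := by
    have h := real_inter_of_isLevel hinv .univ (isTailSet_univ n) hU
    rw [Set.inter_univ] at h
    rw [h, Finset.sum_div]
    exact Finset.sum_congr rfl fun w _ => by rw [hweight, mul_div_assoc]
  refine ⟨ν, ⟨hMD, hν, fun x => ?_, hinv, fun S hS hSinv => ?_⟩, ⟨fun V hV ⟨x, hx⟩ => ?_,
    fun V hV U hU hUV => ?_⟩, ?_⟩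
  · have hlim : Tendsto (fun n => ENNReal.ofReal (∑ w, p w / l ^ n)) atTop (𝓝 0) := by
      rw [← ENNReal.ofReal_zero]
      refine ENNReal.tendsto_ofReal ?_
      simp only [← Finset.sum_div, hp1, one_div, ← inv_pow]
      exact tendsto_pow_atTop_nhds_zero_of_lt_one (by positivity) (inv_lt_one_of_one_lt₀ hl)
    refine le_antisymm (ge_of_tendsto' hlim fun n => ?_) zero_le
    calc ν {x} ≤ ν (cylinder x n) := measure_mono (Set.singleton_subset_iff.2 (mem_cylinder_self x n))
      _ = ENNReal.ofReal (p (x.vertex n) / l ^ n) := hcyl x n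
      _ ≤ _ := ENNReal.ofReal_le_ofReal (Finset.single_le_sum (f := fun w => p w / l ^ n)
        (fun w _ => (hz0 n w).le) (Finset.mem_univ _))
  -- The weights of `ν` restricted to the invariant set `S` solve the same recursion, so the
  -- restriction is a multiple of `ν`; evaluating it at `Sᶜ` gives the dichotomy.
  · have hSn (n : ℕ) : IsTailSet n S := fun x y hxy hx => hSinv x y ⟨n, hxy⟩ hx
    obtain ⟨c, hc0, hc⟩ := exists_eq_mul_of_pos (C := fun w v => (B.incidence w v : ℝ))
      (u := fun n w => weight ν S n w) (v := fun n w => p w / l ^ n)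
      (fun w v => Nat.cast_pos.2 (Nat.pos_of_ne_zero (hpos w v)))
      (fun _ _ => weight_nonneg _ _ _ _) hz0 (fun n w => weight_succ hinv hS (hSn (n + 1)) w) hz
    have hrestr : ν.restrict S = ENNReal.ofReal c • ν := by
      refine measure_ext_cylinder fun x n => ?_
      rw [Measure.restrict_apply (measurableSet_cylinder x n), Measure.smul_apply, hcyl, smul_eq_mul,
        ← ENNReal.ofReal_mul hc0, ← hc, ← real_cylinder_inter hinv hS (hSn n),
        ofReal_measureReal]
    have h0 : ENNReal.ofReal c * ν Sᶜ = 0 := by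
      rw [← smul_eq_mul, ← Measure.smul_apply, ← hrestr, Measure.restrict_apply hS.compl,
        Set.compl_inter_self, measure_empty]
    rcases mul_eq_zero.1 h0 with h | h
    · left
      rw [← Measure.restrict_apply_univ, hrestr, Measure.smul_apply, h, zero_smul]
    · exact Or.inr h
  · obtain ⟨n, hn⟩ := exists_isLevel_of_isClopen hV
    refine lt_of_lt_of_le ?_ (measure_mono (hn x hx))
    rw [hcyl]
    exact ENNReal.ofReal_pos.2 (hz0 _ _)
  · obtain ⟨n₁, hn₁⟩ := exists_isLevel_of_isClopen hU
    obtain ⟨n₂, hn₂⟩ := exists_isLevel_of_isClopen hV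
    have hU' := hn₁.mono (le_max_left n₁ n₂)
    have hV' := hn₂.mono (le_max_right n₁ n₂)
    generalize max n₁ n₂ = n at hU' hV'
    have hlt : ν.real U < ν.real V := (ENNReal.toReal_lt_toReal (measure_ne_top _ _)
      (measure_ne_top _ _)).2 hUV
    rw [hreal hU', hreal hV', div_lt_div_iff_of_pos_right (by positivity)] at hlt
    -- Since `d` has positive value, at a high enough level `V` has at least as many finite paths as
    -- `U` to every vertex; selecting equally many of them gives `W`.
    let d : B.V → ℤ := fun w => levelCount n V w - levelCount n U w
    have hd : 0 < ∑ w, (d w : ℝ) * p w := by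
      simp only [d, Int.cast_sub, Int.cast_natCast, sub_mul, Finset.sum_sub_distrib]
      exact sub_pos.2 hlt
    have hdpush (N : ℕ) : ∀ v, B.incidence.pushRow d N v =
        levelCount (n + N) V v - levelCount (n + N) U v := by
      simp only [← hpush hU', ← hpush hV']
      induction N with
      | zero => exact fun _ => rfl
      | succ N ih =>
        intro v
        simp only [Matrix.pushRow, ih, sub_mul, Finset.sum_sub_distrib]
    choose N hN using fun v => hD.exists_le_pushRow_of_mem hd (Set.mem_univ v) 0
    let N' := Finset.univ.sup N
    obtain ⟨W, hWV, hW, hWU⟩ := exists_subset_levelCount_eq (n := n + N')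
      (hV'.mono (n.le_add_right N')) (levelCount (n + N') U) (fun v => by
        have h := hN v N' (Finset.le_sup (Finset.mem_univ v))
        rw [hdpush] at h
        omega)
    refine ⟨W, hW.isClopen, hWV, ?_⟩
    rw [← measureReal_eq_measureReal_iff, hreal hW, hreal (hU'.mono (n.le_add_right N')), hWU]
  · rw [clopenValues_eq hinv one_pos, ← hD.values_eq B.pathCount ?_ hone
      (exists_le_pathCount hMD.aperiodic)]
    · simp only [hweight, one_mul]
    · intro n v
      rw [← levelCount_univ (n + 1), levelCount_succ (isLevel_univ n), levelCount_univ]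
      rfl

end Positive

/-- The diagram with vertex set `I`, one edge from the top vertex to each vertex of the first level,
and `D i j` edges from `i` to `j`. -/
def ofMatrix (I : Type) [Finite I] [Nonempty I] (D : I → I → ℕ) (hD : ∀ i j, 2 ≤ D i j) :
    StationaryBratteliDiagram where
  V := I
  E₀ := I
  E := Σ p : I × I, Fin (D p.1 p.2)
  finite_V := inferInstance
  finite_E₀ := inferInstance
  finite_E := inferInstance
  rng₀ := id
  src e := e.1.1
  rng e := e.1.2
  nonempty_E₀ := inferInstance
  rng₀_surjective := Function.surjective_id
  src_surjective i := ⟨⟨(i, i), ⟨0, two_pos.trans_le (hD i i)⟩⟩, rfl⟩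
  rng_surjective i := ⟨⟨(i, i), ⟨0, two_pos.trans_le (hD i i)⟩⟩, rfl⟩

theorem incidence_ofMatrix (I : Type) [Finite I] [Nonempty I] (D : I → I → ℕ)
    (hD : ∀ i j, 2 ≤ D i j) (i j : I) : (ofMatrix I D hD).incidence i j = D i j := by
  classical
  rw [← Fintype.card_fin (D i j), ← Finset.card_univ]
  symm
  refine Finset.card_bij (fun t _ => (⟨(i, j), t⟩ : Σ p : I × I, Fin (D p.1 p.2))) ?_ ?_ ?_
  · intro t _
    exact Finset.mem_filter.2 ⟨Finset.mem_univ _, rfl, rfl⟩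
  · intro t _ t' _ h
    exact eq_of_heq (Sigma.mk.inj h).2
  · rintro ⟨⟨i', j'⟩, t⟩ h
    obtain ⟨-, h1, h2⟩ := Finset.mem_filter.1 h
    obtain rfl : i' = i := h1
    obtain rfl : j' = j := h2
    exact ⟨t, Finset.mem_univ _, rfl⟩

theorem exists_simple_diagram (I : Type) [Fintype I] [Nonempty I] (D : I → I → ℕ)
    (hD : ∀ i j, 2 ≤ D i j) {p : I → ℝ} (hp : ∀ i, 0 < p i) (hp1 : ∑ i, p i = 1) {l : ℝ}
    (hl : 1 < l) (heigen : ∀ i, ∑ j, (D i j : ℝ) * p j = l * p i) :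
    ∃ (B : StationaryBratteliDiagram) (ν : Measure B.PathSpace),
      B.MemS ν ∧ B.IsSimple ∧ Function.Bijective B.rng₀ ∧ IsGoodMeasure ν ∧
      clopenValues ν = {a : ℝ | 0 ≤ a ∧ a ≤ 1 ∧
        ∃ (n : ℕ) (k : I → ℤ), l ^ n * a = ∑ i, (k i : ℝ) * p i} := by
  let B := ofMatrix I D hD
  have hsum (F : I → ℝ) : @Finset.sum I ℝ _ (@Finset.univ I B.instFintypeV) F = ∑ i, F i :=
    @Fintype.sum_equiv I I ℝ B.instFintypeV _ _ (Equiv.refl I) F F fun _ => rfl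
  have hB : ∀ w v, 2 ≤ B.incidence w v := fun w v => (hD w v).trans_eq
    (incidence_ofMatrix I D hD w v).symm
  have hbij : Function.Bijective B.rng₀ := Function.bijective_id
  obtain ⟨ν, hν, hgood, hval⟩ := exists_good_measure hB hbij (p := p) hp ((hsum p).trans hp1) hl
    fun w => (Finset.sum_congr rfl fun v _ => congrArg (fun d : ℕ => (d : ℝ) * p v)
      (incidence_ofMatrix I D hD w v)).trans ((hsum fun v => (D w v : ℝ) * p v).trans (heigen w))
  refine ⟨B, ν, hν, isSimple_of_two_le_incidence hB, hbij, hgood, hval.trans ?_⟩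
  ext a
  refine and_congr_right fun _ => and_congr_right fun _ => exists_congr fun n =>
    exists_congr fun k => ?_
  exact Eq.congr_right (hsum fun i => (k i : ℝ) * p i)

end StationaryBratteliDiagram

/-! ### The simple diagram with the same clopen values -/

open StationaryBratteliDiagram in
theorem mainTheorem9 (B : StationaryBratteliDiagram) (μ : Measure B.PathSpace) (hμ : B.MemS μ) :
    ∃ (B' : StationaryBratteliDiagram) (ν : Measure B'.PathSpace),
      B'.MemS ν ∧ B'.IsSimple ∧ Function.Bijective B'.rng₀ ∧ IsGoodMeasure ν ∧
        clopenValues μ = clopenValues ν := by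
  classical
  have := hμ.isProbability
  obtain ⟨p, x, l, α, hp, hD, hX⟩ := exists_isDistinguished hμ
  have hl := hD.pos
  have hX0 (w) : weight μ Set.univ 0 w = x w := by simpa using hX 0 w
  have hone : ∑ w, (B.pathCount 0 w : ℝ) * x w = 1 := by
    have h := real_inter_of_isLevel hμ.invariant .univ (isTailSet_univ 0)
      (isLevel_univ (B := B) 0)
    rw [Set.inter_univ, levelCount_univ, probReal_univ] at h
    rw [h]
    simp only [hX0]
  have hvalues : clopenValues μ = {a : ℝ | 0 ≤ a ∧ a ≤ 1 ∧
      ∃ (n : ℕ) (k : B.V → ℤ), l ^ n * a = ∑ w, (k w : ℝ) * x w} := by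
    rw [clopenValues_eq hμ.invariant hp, ← hD.values_eq (fun j => B.pathCount (p * j)) ?_
      (by simpa using hone) ?_]
    · simp only [hX]
    · intro n v
      rw [Nat.mul_succ, pathCount_add]
      rfl
    · intro c
      obtain ⟨N, hN⟩ := exists_le_pathCount hμ.memD.aperiodic c
      exact ⟨N, fun n hn => hN _ (hn.trans (Nat.le_mul_of_pos_left n hp))⟩
  -- one vertex for each edge from the top vertex to a vertex of positive weight
  let I := {e : B.E₀ // 0 < x (B.rng₀ e)}
  have hsumI (F : B.E₀ → ℝ) (hF : ∀ e, x (B.rng₀ e) = 0 → F e = 0) : ∑ e : I, F e = ∑ e, F e := by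
    rw [← Finset.sum_subtype (Finset.univ.filter fun e => 0 < x (B.rng₀ e)) (by simp) F,
      Finset.sum_filter]
    refine Finset.sum_congr rfl fun e _ => ?_
    split_ifs with he
    · rfl
    · exact (hF e (le_antisymm (not_lt.1 he) (hD.nonneg _))).symm
  -- `s` marks one edge over each vertex of level 1, so a coefficient at a vertex can be placed on a
  -- single new vertex.
  choose s hs using B.rng₀_surjective
  have hsumS (g : B.V → ℝ) :
      ∑ e : I, (if (e : B.E₀) = s (B.rng₀ e) then g (B.rng₀ e) else 0) * x (B.rng₀ e) =
        ∑ v, g v * x v := by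
    rw [hsumI (fun e => (if e = s (B.rng₀ e) then g (B.rng₀ e) else 0) * x (B.rng₀ e))
      (fun e he => by rw [he, mul_zero]), ← Finset.sum_fiberwise _ (fun e => B.rng₀ e)]
    refine Finset.sum_congr rfl fun v _ => ?_
    rw [Finset.sum_eq_single_of_mem (s v) (by simp [hs])]
    · simp [hs]
    · intro e he hes
      rw [(Finset.mem_filter.1 he).2, if_neg hes, zero_mul]
  have hp1 : ∑ e : I, x (B.rng₀ e) = 1 := by
    rw [hsumI (fun e => x (B.rng₀ e)) (fun _ h => h), ← sum_pathCount_zero, hone]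
  have hI : Nonempty I := by
    by_contra h
    rw [not_nonempty_iff] at h
    simp at hp1
  let M := 2 * ∑ v, B.pathCount 0 v
  obtain ⟨N, A', hN, hA'⟩ := hD.exists_large_combination M
  -- The coefficient `A'` at `v` is distributed over the edges ending at `v`: 2 on each, and the
  -- rest on the marked one. The choice of `M` keeps the rest non-negative.
  let D (e f : I) : ℕ := 2 + if (f : B.E₀) = s (B.rng₀ f) then
    A' (B.rng₀ e) (B.rng₀ f) - 2 * B.pathCount 0 (B.rng₀ f) else 0
  have hD2 (e f : I) : 2 ≤ D e f := Nat.le_add_right _ _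
  have heigen (e : I) : ∑ f : I, (D e f : ℝ) * x (B.rng₀ f) = l ^ N * x (B.rng₀ e) := by
    simp only [D, Nat.cast_add, add_mul, Finset.sum_add_distrib, Nat.cast_ite, Nat.cast_zero]
    rw [hsumS (fun v => ((A' (B.rng₀ e) v - 2 * B.pathCount 0 v : ℕ) : ℝ)),
      hsumI (fun f => ((2 : ℕ) : ℝ) * x (B.rng₀ f)) (fun f hf => by rw [hf, mul_zero]),
      ← sum_pathCount_zero (fun v => ((2 : ℕ) : ℝ) * x v), (hA' _ e.2).1, ← Finset.sum_add_distrib]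
    refine Finset.sum_congr rfl fun v _ => ?_
    rcases (hD.nonneg v).eq_or_lt with hv | hv
    · simp [← hv]
    · have h1 : 2 * B.pathCount 0 v ≤ A' (B.rng₀ e) v :=
        (Nat.mul_le_mul_left 2 (Finset.single_le_sum (f := fun v => B.pathCount 0 v)
          (fun _ _ => Nat.zero_le _) (Finset.mem_univ v))).trans ((hA' _ e.2).2 v hv)
      push_cast [h1]
      ring
  obtain ⟨B', ν, hν, hsimple, hbij, hgood, hval⟩ := exists_simple_diagram I D hD2
    (p := fun e : I => x (B.rng₀ e)) (fun e => e.2) hp1 (one_lt_pow₀ hD.one_lt hN.ne') heigen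
  refine ⟨B', ν, hν, hsimple, hbij, hgood, ?_⟩
  rw [hvalues, hval]
  ext a
  refine and_congr_right fun _ => and_congr_right fun _ => ⟨?_, ?_⟩
  -- The new eigenvalue is `l ^ N`, so the exponent is raised from `n` to `N * n` by pushing `k`
  -- forward.
  · rintro ⟨n, k, hk⟩
    have hnN : n ≤ N * n := Nat.le_mul_of_pos_left n hN
    refine ⟨n, fun e : I => if (e : B.E₀) = s (B.rng₀ e) then
      (B.incidence ^ p).pushRow k (N * n - n) (B.rng₀ e) else 0, ?_⟩
    simp only [Int.cast_ite, Int.cast_zero]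
    rw [hsumS (fun v => (((B.incidence ^ p).pushRow k (N * n - n) v : ℤ) : ℝ)), hD.sum_pushRow,
      ← hk, ← mul_assoc, ← pow_add, Nat.sub_add_cancel hnN, pow_mul]
  · rintro ⟨n, k, hk⟩
    -- New vertices over the same old vertex have equal weights, so their coefficients are added.
    refine ⟨N * n, fun v => ∑ e : I, if B.rng₀ e = v then k e else 0, ?_⟩
    rw [pow_mul, hk]
    push_cast
    simp only [Finset.sum_mul]
    rw [Finset.sum_comm]
    refine Finset.sum_congr rfl fun e _ => ?_
    simp
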